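/- Let $\mathbb{C}_+=\{s\in\mathbb{C}:\operatorname{Re}s>0\}$ and let $\mathcal{A}(\mathbb{C}_+)$ be the space of all functions $f:\mathbb{C}_+\to\mathbb{C}$ that are uniformly continuous on $\mathbb{C}_+$ and for which there is a Dirichlet series $\sum_{n\ge1}a_nn^{-s}$ that converges to $f(s)$ at every point $s\in\mathbb{C}_+$, normed by $\|f\|_\infty=\sup_{s\in\mathbb{C}_+}|f(s)|$. Let $B_{c_0}$ be the open unit ball of the space $c_0$ of complex null sequences (with the supremum norm), and let $\mathcal{A}_u(B_{c_0})$ be the space of all functions $g:B_{c_0}\to\mathbb{C}$ that are uniformly continuous and complex Fréchet differentiable on $B_{c_0}$, normed by $\|g\|_{B_{c_0}}=\sup_{z\in B_{c_0}}|g(z)|$. (The functions in both spaces are bounded, so these are finite norms.) Let $p_1<p_2<\cdots$ be the primes, and for a finitely supported sequence $\alpha=(\alpha_1,\alpha_2,\dots)$ of non-negative integers put $p^\alpha=\prod_jp_j^{\alpha_j}$ and $z^\alpha=\prod_jz_j^{\alpha_j}$. Then there is a surjective $\mathbb{C}$-linear isometry $\Phi:\mathcal{A}(\mathbb{C}_+)\to\mathcal{A}_u(B_{c_0})$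 such that 1. for all $f,g\in\mathcal{A}(\mathbb{C}_+)$ the product $fg$ lies in $\mathcal{A}(\mathbb{C}_+)$ and $\Phi(fg)=\Phi(f)\Phi(g)$; 2. for every $\alpha$, with $n=p^\alpha$, the function $s\mapsto n^{-s}$ lies in $\mathcal{A}(\mathbb{C}_+)$ and $\Phi$ maps it to the monomial $z\mapsto z^\alpha$. -/

import Mathlib

open Filter Topology
open scoped ZeroAtInfty

namespace BohrLift

/-- The supremum norm on a linear space of bounded complex functions. -/
noncomputable def supNorm {X : Type*} [Nonempty X] (S : Submodule ℂ (X → ℂ))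
    (hS : ∀ f ∈ S, BddAbove (Set.range fun x => ‖f x‖)) : AddGroupNorm S where
  toFun f := ⨆ x, ‖f.1 x‖
  map_zero' := by simp
  add_le' f g := by
    refine ciSup_le fun x => ?_
    exact (norm_add_le _ _).trans
      (add_le_add (le_ciSup (hS f.1 f.2) x) (le_ciSup (hS g.1 g.2) x))
  neg' f := by simp
  eq_zero_of_map_eq_zero' f hf := by
    ext x
    have h1 : ‖f.1 x‖ ≤ ⨆ x, ‖f.1 x‖ := le_ciSup (hS f.1 f.2) x
    rw [hf] at h1
    simpa using h1

theorem supNorm_smul_le {X : Type*} [Nonempty X] (S : Submodule ℂ (X → ℂ))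
    (hS : ∀ f ∈ S, BddAbove (Set.range fun x => ‖f x‖)) (c : ℂ) (f : S) :
    supNorm S hS (c • f) ≤ ‖c‖ * supNorm S hS f := by
  change (⨆ x, ‖(c • f).1 x‖) ≤ ‖c‖ * ⨆ x, ‖f.1 x‖
  refine ciSup_le fun x => ?_
  have h1 : ‖f.1 x‖ ≤ ⨆ x, ‖f.1 x‖ := le_ciSup (hS f.1 f.2) x
  calc ‖(c • f).1 x‖ = ‖c‖ * ‖f.1 x‖ := by simp
    _ ≤ _ := mul_le_mul_of_nonneg_left h1 (norm_nonneg c)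

/-! ### Uniformly continuous Dirichlet series on the half-plane -/

/-- The open right half-plane `ℂ₊`. -/
abbrev HalfPlane : Type := {s : ℂ // 0 < s.re}

instance : Nonempty HalfPlane := ⟨⟨1, by simp⟩⟩

/-- `f` is the pointwise sum on `ℂ₊` of the Dirichlet series with coefficients `a 1, a 2, …`
(convergence of partial sums, not necessarily absolute). -/
def HasDirichletSeries (a : ℕ → ℂ) (f : HalfPlane → ℂ) : Prop :=
  ∀ s : HalfPlane,
    Tendsto (fun N : ℕ => ∑ n ∈ Finset.Icc 1 N, a n * (n : ℂ) ^ (-(s : ℂ))) atTop (𝓝 (f s))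

/-- The functions on `ℂ₊` that are sums of a Dirichlet series converging on `ℂ₊` and are
uniformly continuous there. -/
def dirichletSubmodule : Submodule ℂ (HalfPlane → ℂ) where
  carrier := {f | (∃ a : ℕ → ℂ, HasDirichletSeries a f) ∧ UniformContinuous f}
  zero_mem' := ⟨⟨0, fun s => by simp⟩, uniformContinuous_const⟩
  add_mem' := by
    rintro f g ⟨⟨a, ha⟩, hf⟩ ⟨⟨b, hb⟩, hg⟩
    refine ⟨⟨a + b, fun s => ?_⟩, hf.add hg⟩
    have := (ha s).add (hb s)
    simpa [add_mul, Finset.sum_add_distrib] using this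
  smul_mem' := by
    rintro c f ⟨⟨a, ha⟩, hf⟩
    refine ⟨⟨c • a, fun s => ?_⟩, hf.const_smul c⟩
    have := (ha s).const_mul c
    simpa [Finset.mul_sum, mul_assoc] using this

theorem bounded_of_mem_dirichletSubmodule (f : HalfPlane → ℂ) (hf : f ∈ dirichletSubmodule) :
    BddAbove (Set.range fun s => ‖f s‖) := by
  obtain ⟨⟨a, ha⟩, hu⟩ := hf
  obtain ⟨M, hM⟩ : ∃ M : ℝ, ∀ s : HalfPlane, 2 ≤ (s : ℂ).re → ‖f s‖ ≤ M := by
    have h0 := ha ⟨(1 / 2 : ℝ), by rw [Complex.ofReal_re]; norm_num⟩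
    obtain ⟨C, hC⟩ := h0.norm.bddAbove_range
    have hb : ∀ n : ℕ, 1 ≤ n → ‖a n‖ * (n : ℝ) ^ (-(1 / 2) : ℝ) ≤ 2 * C := by
      intro n hn
      obtain ⟨m, rfl⟩ : ∃ m, n = m + 1 := ⟨n - 1, by omega⟩
      have h1 := hC ⟨m, rfl⟩
      have h2 := hC ⟨m + 1, rfl⟩
      have h3 : ‖a (m + 1) * ((m + 1 : ℕ) : ℂ) ^ (-((1 / 2 : ℝ) : ℂ))‖
          = ‖a (m + 1)‖ * ((m + 1 : ℕ) : ℝ) ^ (-(1 / 2) : ℝ) := by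
        rw [norm_mul, Complex.norm_natCast_cpow_of_pos (Nat.succ_pos m)]
        simp
      rw [← h3]
      beta_reduce at h1 h2
      rw [Finset.sum_Icc_succ_top (Nat.le_add_left 1 m)] at h2
      have h4 := norm_le_add_norm_add' (∑ n ∈ Finset.Icc 1 m, a n * (n : ℂ) ^ (-((1 / 2 : ℝ) : ℂ)))
        (a (m + 1) * ((m + 1 : ℕ) : ℂ) ^ (-((1 / 2 : ℝ) : ℂ)))
      linarith
    have hsum : Summable fun n : ℕ => (2 * C) * (n : ℝ) ^ (-(3 / 2) : ℝ) :=
      (Real.summable_nat_rpow.2 (by norm_num)).mul_left _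
    refine ⟨∑' n : ℕ, (2 * C) * (n : ℝ) ^ (-(3 / 2) : ℝ), fun s hs => ?_⟩
    have hC0 : 0 ≤ C := (norm_nonneg _).trans (hC ⟨0, rfl⟩)
    refine le_of_tendsto (ha s).norm (Eventually.of_forall fun N => ?_)
    refine (norm_sum_le _ _).trans ((Finset.sum_le_sum fun n hn => ?_).trans
      (hsum.sum_le_tsum (Finset.Icc 1 N) fun n _ => by positivity))
    have hn1 : 1 ≤ n := (Finset.mem_Icc.1 hn).1
    have hn0 : (1 : ℝ) ≤ n := by exact_mod_cast hn1
    rw [norm_mul, Complex.norm_natCast_cpow_of_pos hn1]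
    calc ‖a n‖ * (n : ℝ) ^ (-(s : ℂ)).re
        ≤ ‖a n‖ * (n : ℝ) ^ (-(1 / 2) + -(3 / 2) : ℝ) := by
          refine mul_le_mul_of_nonneg_left (Real.rpow_le_rpow_of_exponent_le hn0 ?_)
            (norm_nonneg _)
          simp only [Complex.neg_re]
          linarith
      _ = (‖a n‖ * (n : ℝ) ^ (-(1 / 2) : ℝ)) * (n : ℝ) ^ (-(3 / 2) : ℝ) := by
          rw [Real.rpow_add (by linarith), mul_assoc]
      _ ≤ _ := mul_le_mul_of_nonneg_right (hb n hn1) (by positivity)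
  obtain ⟨δ, hδ, hfδ⟩ := Metric.uniformContinuous_iff.1 hu 1 one_pos
  obtain ⟨k, hk⟩ := exists_nat_gt (2 / (δ / 2))
  have hkδ : 2 ≤ (k : ℝ) * (δ / 2) := by
    rw [div_lt_iff₀ (by positivity)] at hk
    exact hk.le
  have hstep : ∀ j : ℕ, ∀ s : HalfPlane, 2 ≤ (s : ℂ).re + j * (δ / 2) → ‖f s‖ ≤ M + j := by
    intro j
    induction j with
    | zero => intro s hs; simpa using hM s (by simpa using hs)
    | succ j ih =>
      intro s hs
      have hre : ((s : ℂ) + ((δ / 2 : ℝ) : ℂ)).re = (s : ℂ).re + δ / 2 := by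
        rw [Complex.add_re, Complex.ofReal_re]
      let t : HalfPlane := ⟨(s : ℂ) + ((δ / 2 : ℝ) : ℂ), by
        rw [hre]; have := s.2; positivity⟩
      have h1 : ‖f t‖ ≤ M + j := ih t (by
        change 2 ≤ ((s : ℂ) + ((δ / 2 : ℝ) : ℂ)).re + j * (δ / 2)
        rw [hre]; push_cast at hs; linarith)
      have h2 : dist (f s) (f t) < 1 := hfδ (by
        rw [Subtype.dist_eq, dist_eq_norm]
        change ‖(s : ℂ) - ((s : ℂ) + ((δ / 2 : ℝ) : ℂ))‖ < δ
        rw [sub_add_cancel_left, norm_neg, Complex.norm_real, Real.norm_eq_abs,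
          abs_of_pos (by positivity)]
        linarith)
      rw [dist_eq_norm] at h2
      have h3 := norm_le_norm_add_norm_sub' (f s) (f t)
      push_cast
      linarith
  refine ⟨M + k, ?_⟩
  rintro _ ⟨s, rfl⟩
  exact hstep k s (by have := s.2; linarith)

/-- The space `𝒜(ℂ₊)`. -/
def DirichletAlgebra : Type := dirichletSubmodule

namespace DirichletAlgebra

instance : AddCommGroup DirichletAlgebra := inferInstanceAs (AddCommGroup dirichletSubmodule)

instance : Module ℂ DirichletAlgebra := inferInstanceAs (Module ℂ dirichletSubmodule)

instance : FunLike DirichletAlgebra HalfPlane ℂ where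
  coe f := f.1
  coe_injective := Subtype.val_injective

/-- The norm is `‖f‖ = sup {‖f s‖ : s ∈ ℂ₊}`. -/
noncomputable instance : NormedAddCommGroup DirichletAlgebra :=
  AddGroupNorm.toNormedAddCommGroup (E := DirichletAlgebra)
    (supNorm dirichletSubmodule bounded_of_mem_dirichletSubmodule)

noncomputable instance : NormedSpace ℂ DirichletAlgebra where
  norm_smul_le := supNorm_smul_le dirichletSubmodule bounded_of_mem_dirichletSubmodule

theorem norm_def (f : DirichletAlgebra) : ‖f‖ = ⨆ s : HalfPlane, ‖f s‖ := rfl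

end DirichletAlgebra

/-! ### Uniformly continuous holomorphic functions on the ball of `c₀` -/

/-- The open unit ball of `c₀`, the null sequences with the supremum norm. -/
abbrev BallC0 : Type := Metric.ball (0 : C₀(ℕ, ℂ)) 1

instance : Nonempty BallC0 := ⟨⟨0, by simp⟩⟩

/-- The functions on the open unit ball of `c₀` that are uniformly continuous and complex
Fréchet differentiable. -/
def ballSubmodule : Submodule ℂ (BallC0 → ℂ) where
  carrier := {f | UniformContinuous f ∧ ∃ F : C₀(ℕ, ℂ) → ℂ,
    DifferentiableOn ℂ F (Metric.ball 0 1) ∧ ∀ z : BallC0, f z = F z}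
  zero_mem' := ⟨uniformContinuous_const, 0, differentiableOn_const 0, fun _ => rfl⟩
  add_mem' := by
    rintro f g ⟨hf, F, hF, hfF⟩ ⟨hg, G, hG, hgG⟩
    exact ⟨hf.add hg, F + G, hF.add hG, fun z => by simp [hfF, hgG]⟩
  smul_mem' := by
    rintro c f ⟨hf, F, hF, hfF⟩
    exact ⟨hf.const_smul c, c • F, hF.const_smul c, fun z => by simp [hfF]⟩

theorem bounded_of_mem_ballSubmodule (f : BallC0 → ℂ) (hf : f ∈ ballSubmodule) :
    BddAbove (Set.range fun z => ‖f z‖) := by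
  obtain ⟨δ, hδ, hfδ⟩ := Metric.uniformContinuous_iff.1 hf.1 1 one_pos
  obtain ⟨k, hk⟩ := exists_nat_gt (1 / δ)
  have hkδ : 1 < (k : ℝ) * δ := (div_lt_iff₀ hδ).1 hk
  have hstep : ∀ j : ℕ, ∀ z : BallC0, ‖(z : C₀(ℕ, ℂ))‖ ≤ j / k →
      ‖f z‖ ≤ ‖f ⟨0, by simp⟩‖ + j := by
    have hk0 : (0 : ℝ) < k := lt_trans (by positivity) hk
    intro j
    induction j with
    | zero =>
      intro z hz
      have hz0 : (z : C₀(ℕ, ℂ)) = 0 := by simpa using hz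
      have : z = ⟨0, by simp⟩ := Subtype.ext hz0
      simp [this]
    | succ j ih =>
      intro z hz
      have hj : (0 : ℝ) < j + 1 := by positivity
      have hz1 : ‖(z : C₀(ℕ, ℂ))‖ < 1 := mem_ball_zero_iff.1 z.2
      let c : ℝ := j / (j + 1)
      have hc0 : 0 ≤ c := by positivity
      have hc1 : 1 - c = 1 / (j + 1) := by simp only [c]; field_simp; ring
      have hcle : c ≤ 1 := by
        have : 0 < 1 - c := by rw [hc1]; positivity
        linarith
      have hnorm : ‖(c : ℂ) • (z : C₀(ℕ, ℂ))‖ = c * ‖(z : C₀(ℕ, ℂ))‖ := by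
        rw [norm_smul, Complex.norm_real, Real.norm_of_nonneg hc0]
      let w : BallC0 := ⟨(c : ℂ) • (z : C₀(ℕ, ℂ)), by
        rw [mem_ball_zero_iff, hnorm]
        exact (mul_le_of_le_one_left (norm_nonneg _) hcle).trans_lt hz1⟩
      push_cast at hz
      have h1 : ‖f w‖ ≤ ‖f ⟨0, by simp⟩‖ + j := ih w (by
        change ‖(c : ℂ) • (z : C₀(ℕ, ℂ))‖ ≤ j / k
        rw [hnorm]
        calc c * ‖(z : C₀(ℕ, ℂ))‖ ≤ c * ((j + 1) / k) := mul_le_mul_of_nonneg_left hz hc0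
          _ = j / k := by simp only [c]; field_simp)
      have h2 : dist (f z) (f w) < 1 := hfδ (by
        rw [Subtype.dist_eq, dist_eq_norm]
        change ‖(z : C₀(ℕ, ℂ)) - (c : ℂ) • (z : C₀(ℕ, ℂ))‖ < δ
        have : (z : C₀(ℕ, ℂ)) - (c : ℂ) • (z : C₀(ℕ, ℂ))
            = ((1 - c : ℝ) : ℂ) • (z : C₀(ℕ, ℂ)) := by
          ext i; simp; ring
        rw [this, norm_smul, Complex.norm_real, Real.norm_of_nonneg (by linarith), hc1]
        calc 1 / ((j : ℝ) + 1) * ‖(z : C₀(ℕ, ℂ))‖ ≤ 1 / ((j : ℝ) + 1) * ((j + 1) / k) :=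
              mul_le_mul_of_nonneg_left hz (by positivity)
          _ = 1 / k := by field_simp
          _ < δ := by rw [div_lt_iff₀ hk0]; linarith)
      rw [dist_eq_norm] at h2
      have h3 := norm_le_norm_add_norm_sub' (f z) (f w)
      push_cast
      linarith
  refine ⟨‖f ⟨0, by simp⟩‖ + k, ?_⟩
  rintro _ ⟨z, rfl⟩
  have hk0 : (k : ℝ) ≠ 0 := by rintro h; rw [h] at hkδ; linarith
  have hz1 : ‖(z : C₀(ℕ, ℂ))‖ < 1 := mem_ball_zero_iff.1 z.2
  exact hstep k z (by rw [div_self hk0]; exact hz1.le)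

/-- The space `𝒜ᵤ(B_{c₀})`. -/
def BallAlgebra : Type := ballSubmodule

namespace BallAlgebra

instance : AddCommGroup BallAlgebra := inferInstanceAs (AddCommGroup ballSubmodule)

instance : Module ℂ BallAlgebra := inferInstanceAs (Module ℂ ballSubmodule)

instance : FunLike BallAlgebra BallC0 ℂ where
  coe f := f.1
  coe_injective := Subtype.val_injective

/-- The norm is `‖f‖ = sup {‖f z‖ : z ∈ B_{c₀}}`. -/
noncomputable instance : NormedAddCommGroup BallAlgebra :=
  AddGroupNorm.toNormedAddCommGroup (E := BallAlgebra)
    (supNorm ballSubmodule bounded_of_mem_ballSubmodule)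

noncomputable instance : NormedSpace ℂ BallAlgebra where
  norm_smul_le := supNorm_smul_le ballSubmodule bounded_of_mem_ballSubmodule

theorem norm_def (f : BallAlgebra) : ‖f‖ = ⨆ z : BallC0, ‖f z‖ := rfl

end BallAlgebra

/-! ### Multi-indices -/

/-- `p ^ α = ∏ p_j ^ α_j`, where `p_0 < p_1 < …` are the primes. -/
noncomputable def primePow (α : ℕ →₀ ℕ) : ℕ := α.prod fun j k => Nat.nth Nat.Prime j ^ k

/-- The monomial `z ^ α = ∏ z_j ^ α_j`. -/
noncomputable def monomial (α : ℕ →₀ ℕ) (z : BallC0) : ℂ :=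
  α.prod fun j k => (z : C₀(ℕ, ℂ)) j ^ k

end BohrLift

/-!
Both algebras are restrictions of one algebra, the uniform closure of the polynomials in the
coordinates on the infinite polydisc. Call a family of points of the polydisc norming if every
polynomial obeys on the whole polydisc any bound it obeys at these points; restriction to a norming
family is an isometry of the polydisc algebra onto the uniform limits of restricted polynomials.
A null sequence in the ball is itself a point of the polydisc, and Bohr's correspondence sends `s`
in the half-plane to the point `(p_j ^ (-s))_j`.

The ball is norming because it is dense in the polydisc. A uniformly continuous holomorphic function
on the ball is uniformly close to its dilations, hence to Taylor polynomials. A bounded polynomial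
on `c₀` depends on finitely many coordinates up to a small error: otherwise a gliding hump of
disjointly supported vectors would make it unbounded on the unit ball.

For the half-plane, smooth truncation on the frequency side and summation by parts bound every
partial sum, and hence every coefficient, of a Dirichlet polynomial by its supremum. For a
polynomial in finitely many primes the resulting absolutely convergent series bounds it on the
polydisc up to a constant, and applying this to its powers removes the constant. The bound on
partial sums also makes Dirichlet series converge for uniform limits. Conversely, a uniformly
continuous function with a Dirichlet series is the uniform limit of its vertical convolutions with
band-limited kernels, which are Dirichlet polynomials because such a kernel annihilates the large
frequencies `log n`.
-/

namespace BohrLift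

/-! ### The infinite polydisc algebra -/

/-- The closed infinite polydisc, with the product topology. -/
abbrev Polydisc : Type := ℕ → Metric.closedBall (0 : ℂ) 1

/-- A polynomial as a continuous function on the closed polydisc. -/
noncomputable def polyMap : MvPolynomial ℕ ℂ →ₐ[ℂ] C(Polydisc, ℂ) :=
  MvPolynomial.aeval fun j => ⟨fun ω => ω j, by fun_prop⟩

theorem polyMap_apply (p : MvPolynomial ℕ ℂ) (ω : Polydisc) :
    polyMap p ω = MvPolynomial.eval (fun j => (ω j : ℂ)) p := by
  have : (ContinuousMap.evalAlgHom ℂ ℂ ω).comp polyMap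
      = MvPolynomial.aeval fun j => (ω j : ℂ) :=
    MvPolynomial.algHom_ext fun j => by simp [polyMap]
  exact DFunLike.congr_fun this p

/-- The uniform closure of the polynomials on the closed polydisc. It is the common model of
`DirichletAlgebra` and `BallAlgebra`. -/
noncomputable def polydiscAlgebra : Subalgebra ℂ C(Polydisc, ℂ) :=
  polyMap.range.topologicalClosure

theorem polyMap_mem_polydiscAlgebra (p : MvPolynomial ℕ ℂ) : polyMap p ∈ polydiscAlgebra :=
  polyMap.range.le_topologicalClosure ⟨p, rfl⟩

theorem exists_norm_sub_polyMap_lt {F : C(Polydisc, ℂ)} (hF : F ∈ polydiscAlgebra) {ε : ℝ}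
    (hε : 0 < ε) : ∃ p, ‖F - polyMap p‖ < ε := by
  obtain ⟨_, ⟨p, rfl⟩, hp⟩ := Metric.mem_closure_iff.1 hF ε hε
  exact ⟨p, by rwa [← dist_eq_norm]⟩

section Norming

variable {X : Type*}

/-- A family of points of the polydisc is norming if the norm of every polynomial is its supremum
along the family. -/
def IsNorming (u : X → Polydisc) : Prop :=
  ∀ (p : MvPolynomial ℕ ℂ) (M : ℝ), (∀ x, ‖polyMap p (u x)‖ ≤ M) → ‖polyMap p‖ ≤ M

/-- `f` is a uniform limit of polynomials along the family of points `u`. -/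
def IsPolyLimit (u : X → Polydisc) (f : X → ℂ) : Prop :=
  ∀ ε > 0, ∃ p : MvPolynomial ℕ ℂ, ∀ x, ‖f x - polyMap p (u x)‖ ≤ ε

variable {u : X → Polydisc}

theorem isNorming_of_denseRange (hu : DenseRange u) : IsNorming u := fun p _ hM =>
  (polyMap p).norm_le_of_nonempty.2 fun ω =>
    hu.induction_on ω (isClosed_le (polyMap p).continuous.norm continuous_const) hM

theorem IsNorming.norm_le (hu : IsNorming u) {F : C(Polydisc, ℂ)} (hF : F ∈ polydiscAlgebra)
    {M : ℝ} (hM : ∀ x, ‖F (u x)‖ ≤ M) : ‖F‖ ≤ M := by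
  refine le_of_forall_pos_le_add fun ε hε => ?_
  obtain ⟨p, hp⟩ := exists_norm_sub_polyMap_lt hF (half_pos hε)
  have hpu : ‖polyMap p‖ ≤ M + ε / 2 := hu p _ fun x =>
    (norm_le_norm_add_norm_sub (F (u x)) _).trans
      (add_le_add (hM x) (((F - polyMap p).norm_coe_le_norm (u x)).trans hp.le))
  linarith [norm_le_norm_add_norm_sub' F (polyMap p)]

theorem isPolyLimit_comp {F : C(Polydisc, ℂ)} (hF : F ∈ polydiscAlgebra) (u : X → Polydisc) :
    IsPolyLimit u fun x => F (u x) := fun _ hε =>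
  (exists_norm_sub_polyMap_lt hF hε).imp fun p hp x =>
    ((F - polyMap p).norm_coe_le_norm (u x)).trans hp.le

theorem IsNorming.exists_mem_polydiscAlgebra (hu : IsNorming u) {f : X → ℂ}
    (hf : IsPolyLimit u f) : ∃ F ∈ polydiscAlgebra, ∀ x, F (u x) = f x := by
  choose p hp using fun n : ℕ => hf (1 / (n + 1)) Nat.one_div_pos_of_nat
  have hlim : Tendsto (fun n : ℕ => 1 / ((n : ℝ) + 1)) atTop (𝓝 0) :=
    tendsto_one_div_add_atTop_nhds_zero_nat
  have hcauchy : CauchySeq fun n => polyMap (p n) := by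
    refine cauchySeq_of_le_tendsto_0 (fun n => 1 / ((n : ℝ) + 1) + 1 / (n + 1))
      (fun n m N hn hm => ?_) (by simpa using hlim.add hlim)
    rw [dist_eq_norm, ← map_sub]
    refine hu _ _ fun x => ?_
    rw [map_sub, ContinuousMap.sub_apply]
    refine (norm_sub_le_norm_sub_add_norm_sub _ (f x) _).trans (add_le_add ?_ ?_)
    · rw [norm_sub_rev]
      exact (hp n x).trans (Nat.one_div_le_one_div hn)
    · exact (hp m x).trans (Nat.one_div_le_one_div hm)
  obtain ⟨F, hF⟩ := cauchySeq_tendsto_of_complete hcauchy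
  refine ⟨F, mem_closure_of_tendsto hF (Eventually.of_forall fun n => ⟨p n, rfl⟩), fun x => ?_⟩
  have hFx : Tendsto (fun n => polyMap (p n) (u x)) atTop (𝓝 (F (u x))) :=
    ((continuous_eval_const (u x)).tendsto F).comp hF
  exact tendsto_nhds_unique hFx (tendsto_iff_norm_sub_tendsto_zero.2
    (squeeze_zero (fun _ => norm_nonneg _) (fun n => by
      rw [norm_sub_rev]; exact hp n x) hlim))

theorem IsNorming.iSup_norm_eq [Nonempty X] (hu : IsNorming u) {F : C(Polydisc, ℂ)}
    (hF : F ∈ polydiscAlgebra) : ⨆ x, ‖F (u x)‖ = ‖F‖ :=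
  le_antisymm (ciSup_le fun x => F.norm_coe_le_norm (u x))
    (hu.norm_le hF fun x => le_ciSup (f := fun x => ‖F (u x)‖)
      ⟨‖F‖, Set.forall_mem_range.2 fun x => F.norm_coe_le_norm (u x)⟩ x)

/-- Restriction of the functions in the polydisc algebra to the family of points `u`. -/
noncomputable def restrict (u : X → Polydisc) : polydiscAlgebra →ₗ[ℂ] X → ℂ where
  toFun F x := (F : C(Polydisc, ℂ)) (u x)
  map_add' _ _ := rfl
  map_smul' _ _ := rfl

theorem IsNorming.restrict_injective (hu : IsNorming u) : Function.Injective (restrict u) :=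
  (injective_iff_map_eq_zero _).2 fun F hF => Subtype.ext <| norm_le_zero_iff.1 <|
    hu.norm_le F.2 fun x => (norm_eq_zero.2 (congrFun hF x)).le

theorem IsNorming.mem_range_restrict_iff (hu : IsNorming u) {f : X → ℂ} :
    f ∈ LinearMap.range (restrict u) ↔ IsPolyLimit u f := by
  constructor
  · rintro ⟨F, rfl⟩
    exact isPolyLimit_comp F.2 u
  · intro hf
    obtain ⟨F, hF, hFf⟩ := hu.exists_mem_polydiscAlgebra hf
    exact ⟨⟨F, hF⟩, funext hFf⟩

/-- Restriction to a norming family of points, as a linear equivalence of the polydisc algebra with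
the space of uniform limits of polynomials along that family. -/
noncomputable def IsNorming.restrictEquiv (hu : IsNorming u) {S : Submodule ℂ (X → ℂ)}
    (hS : ∀ f, f ∈ S ↔ IsPolyLimit u f) : polydiscAlgebra ≃ₗ[ℂ] S :=
  (LinearEquiv.ofInjective (restrict u) hu.restrict_injective).trans <| LinearEquiv.ofEq _ _ <|
    Submodule.ext fun f => hu.mem_range_restrict_iff.trans (hS f).symm

end Norming

/-! ### Entire functions of polynomial growth -/

section PolyGrowth

open Asymptotics

variable {E : Type*} [NormedAddCommGroup E] [NormedSpace ℂ E]

/-- A function on a complex normed space that is entire on every complex line and grows at most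
like `‖z‖ ^ m`; it plays the role of a polynomial of degree at most `m`. -/
structure PolyGrowth (m : ℕ) (P : E → ℂ) : Prop where
  entire : ∀ z u : E, Differentiable ℂ fun c : ℂ => P (z + c • u)
  growth : P =O[⊤] fun z => (1 + ‖z‖) ^ m

namespace PolyGrowth

variable {m : ℕ} {P : E → ℂ}

theorem exists_norm_le (hP : PolyGrowth m P) : ∃ C > 0, ∀ z, ‖P z‖ ≤ C * (1 + ‖z‖) ^ m := by
  obtain ⟨C, hC0, hC⟩ := hP.growth.exists_pos
  refine ⟨C, hC0, fun z => (isBigOWith_top.1 hC z).trans_eq ?_⟩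
  rw [Real.norm_of_nonneg (by positivity)]

theorem exists_norm_le_of_norm_le (hP : PolyGrowth m P) (R : ℝ) :
    ∃ M > 0, ∀ z, ‖z‖ ≤ R → ‖P z‖ ≤ M := by
  obtain ⟨C, hC0, hC⟩ := hP.exists_norm_le
  refine ⟨C * (1 + |R|) ^ m, by positivity, fun z hz => (hC z).trans ?_⟩
  gcongr
  exact hz.trans (le_abs_self R)

theorem mono {n : ℕ} (hmn : m ≤ n) (hP : PolyGrowth m P) : PolyGrowth n P :=
  ⟨hP.entire, hP.growth.trans <| isBigO_top.2 ⟨1, fun z => by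
    have hz : 1 ≤ 1 + ‖z‖ := le_add_of_nonneg_right (norm_nonneg z)
    rw [one_mul, Real.norm_of_nonneg (by positivity), Real.norm_of_nonneg (by positivity)]
    exact pow_le_pow_right₀ hz hmn⟩⟩

theorem const_mul (c : ℂ) (hP : PolyGrowth m P) : PolyGrowth m fun z => c * P z :=
  ⟨fun z u => (hP.entire z u).const_mul c, hP.growth.const_mul_left c⟩

theorem sum {ι : Type*} {s : Finset ι} {P : ι → E → ℂ} (hP : ∀ i ∈ s, PolyGrowth m (P i)) :
    PolyGrowth m fun z => ∑ i ∈ s, P i z :=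
  ⟨fun z u => Differentiable.fun_sum fun i hi => (hP i hi).entire z u,
    IsBigO.fun_sum fun i hi => (hP i hi).growth⟩

theorem translate (hP : PolyGrowth m P) (u : E) : PolyGrowth m fun z => P (z + u) := by
  obtain ⟨C, hC0, hC⟩ := hP.exists_norm_le
  refine ⟨fun z v => by simpa only [add_right_comm] using hP.entire (z + u) v,
    isBigO_top.2 ⟨C * (1 + ‖u‖) ^ m, fun z => (hC _).trans ?_⟩⟩
  rw [Real.norm_of_nonneg (by positivity), mul_assoc, ← mul_pow]
  gcongr
  nlinarith [norm_add_le z u, norm_nonneg z, norm_nonneg u]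

theorem norm_add_sub_le (hP : PolyGrowth m P) {z u : E} {M ρ : ℝ} (hρ : 1 < ρ)
    (hM : ∀ c : ℂ, ‖c‖ < ρ → ‖P (z + c • u)‖ ≤ M) : ‖P (z + u) - P z‖ ≤ 2 * M / ρ := by
  have h := Complex.dist_le_div_mul_dist_of_mapsTo_ball (f := fun c : ℂ => P (z + c • u)) (c := 0)
    (z := 1) (R₁ := ρ) (R₂ := 2 * M) (hP.entire z u).differentiableOn
    (fun c hc => by
      rw [mem_closedBall_iff_norm, two_mul]
      exact (norm_sub_le _ _).trans (add_le_add (hM c (mem_ball_zero_iff.1 hc))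
        (hM 0 (by simpa using zero_lt_one.trans hρ)))) (by simpa using hρ)
  simpa [dist_eq_norm] using h

theorem exists_lipschitz (hP : PolyGrowth m P) (R : ℝ) :
    ∃ L > 0, ∀ z w : E, ‖z‖ ≤ R → ‖w‖ ≤ R → ‖P z - P w‖ ≤ L * ‖z - w‖ := by
  obtain ⟨M, hM0, hM⟩ := hP.exists_norm_le_of_norm_le (R + 1)
  refine ⟨2 * M, by positivity, fun z w hz hw => ?_⟩
  rcases eq_or_ne z w with rfl | hzw
  · simp
  have hd : 0 < ‖z - w‖ := norm_pos_iff.2 (sub_ne_zero.2 hzw)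
  rcases lt_or_ge ‖z - w‖ 1 with h1 | h1
  · have h := hP.norm_add_sub_le (z := w) (u := z - w) (M := M) (ρ := ‖z - w‖⁻¹)
      ((one_lt_inv₀ hd).2 h1) fun c hc => hM _ <| (norm_add_le _ _).trans <| add_le_add hw <| by
        rw [norm_smul]
        exact (lt_inv_mul_iff₀' hd).1 (by simpa using hc) |>.le
    simpa only [add_sub_cancel, div_inv_eq_mul] using h
  · calc ‖P z - P w‖ ≤ ‖P z‖ + ‖P w‖ := norm_sub_le _ _
      _ ≤ M + M := add_le_add (hM z (by linarith)) (hM w (by linarith))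
      _ ≤ 2 * M * ‖z - w‖ := by nlinarith

theorem continuous (hP : PolyGrowth m P) : Continuous P := by
  refine continuous_iff_continuousAt.2 fun z => ?_
  obtain ⟨L, -, hL⟩ := hP.exists_lipschitz (‖z‖ + 1)
  refine continuousAt_of_locally_lipschitz one_pos L fun w hw => ?_
  rw [dist_eq_norm] at hw
  simp only [dist_eq_norm]
  exact hL w z (by linarith [norm_le_norm_add_norm_sub' w z]) (by linarith)

/-- Cauchy's estimate on the disc of radius `(1 + ‖z‖) / (1 + ‖u‖)` gains one power of `‖z‖`. -/
theorem difference (hP : PolyGrowth (m + 1) P) (u : E) :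
    PolyGrowth m fun z => P (z + u) - P z := by
  obtain ⟨C, hC0, hC⟩ := hP.exists_norm_le
  refine ⟨fun z v => ((hP.translate u).entire z v).sub (hP.entire z v),
    isBigO_top.2 ⟨2 * C * 2 ^ (m + 1) * (1 + ‖u‖) ^ (m + 1), fun z => ?_⟩⟩
  have hu := norm_nonneg u
  have hz := norm_nonneg z
  rw [Real.norm_of_nonneg (by positivity)]
  have hbound : ∀ {c : ℂ} {r : ℝ}, ‖z‖ ≤ r → ‖c‖ * ‖u‖ ≤ 1 + r →
      ‖P (z + c • u)‖ ≤ C * (2 * (1 + r)) ^ (m + 1) := fun {c r} hzr hcr => (hC _).trans <| by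
    gcongr
    linarith [norm_add_le z (c • u), norm_smul c u]
  rcases lt_or_ge ‖u‖ ‖z‖ with h | h
  · have h1 := hP.norm_add_sub_le (z := z) (u := u) (ρ := (1 + ‖z‖) / (1 + ‖u‖))
      (M := C * (2 * (1 + ‖z‖)) ^ (m + 1)) (by rw [one_lt_div (by positivity)]; linarith)
      fun c hc => hbound le_rfl (by
        rw [lt_div_iff₀ (by positivity)] at hc
        nlinarith [norm_nonneg c])
    calc _ ≤ 2 * (C * (2 * (1 + ‖z‖)) ^ (m + 1)) / ((1 + ‖z‖) / (1 + ‖u‖)) := h1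
      _ = 2 * C * 2 ^ (m + 1) * (1 + ‖u‖) ^ 1 * (1 + ‖z‖) ^ m := by
        rw [mul_pow, pow_succ (1 + ‖z‖)]
        field_simp
      _ ≤ _ := by
        gcongr
        · linarith
        · omega
  · have h1 := hbound (c := 1) h (by rw [norm_one]; linarith)
    have h0 := hbound (c := 0) h (by rw [norm_zero]; linarith)
    simp only [one_smul, zero_smul, add_zero] at h1 h0
    calc _ ≤ ‖P (z + u)‖ + ‖P z‖ := norm_sub_le _ _
      _ ≤ 2 * C * 2 ^ (m + 1) * (1 + ‖u‖) ^ (m + 1) * 1 := by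
        rw [mul_pow] at h0 h1
        linarith
      _ ≤ _ := by
        gcongr
        exact one_le_pow₀ (by linarith)

theorem eq_const (hP : PolyGrowth 0 P) (z w : E) : P z = P w := by
  obtain ⟨C, -, hC⟩ := hP.exists_norm_le
  have h := (hP.entire w (z - w)).apply_eq_apply_of_bounded (isBounded_iff_forall_norm_le.2
    ⟨C, Set.forall_mem_range.2 fun c => by simpa using hC (w + c • (z - w))⟩) 1 0
  simpa using h

theorem comp_line (hP : PolyGrowth m P) (z u : E) : PolyGrowth m fun c : ℂ => P (z + c • u) := by
  obtain ⟨C, hC0, hC⟩ := hP.exists_norm_le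
  refine ⟨fun a b => (hP.entire z u).comp (by fun_prop),
    isBigO_top.2 ⟨C * (1 + ‖z‖ + ‖u‖) ^ m, fun c => (hC _).trans ?_⟩⟩
  rw [Real.norm_of_nonneg (by positivity), mul_assoc, ← mul_pow]
  gcongr
  nlinarith [norm_add_le z (c • u), norm_smul c u, norm_nonneg z, norm_nonneg u, norm_nonneg c]

end PolyGrowth

theorem iteratedDeriv_eq_zero_of_growth {φ : ℂ → ℂ} (hφ : Differentiable ℂ φ) {m n : ℕ}
    (hmn : m < n) {C : ℝ} (hC : ∀ c, ‖φ c‖ ≤ C * (1 + ‖c‖) ^ m) : iteratedDeriv n φ 0 = 0 := by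
  have hC0 : 0 ≤ C := by simpa using (norm_nonneg _).trans (hC 0)
  have hlim : Tendsto (fun R : ℝ => n.factorial * (C * 2 ^ m) / R) atTop (𝓝 0) :=
    tendsto_const_nhds.div_atTop tendsto_id
  refine norm_le_zero_iff.1 (ge_of_tendsto hlim ?_)
  filter_upwards [eventually_ge_atTop 1] with R hR
  have hR0 : 0 < R := by linarith
  refine (Complex.norm_iteratedDeriv_le_of_forall_mem_sphere_norm_le (C := C * (2 * R) ^ m) n hR0
    hφ.diffContOnCl fun c hc => (hC c).trans ?_).trans ?_
  · rw [mem_sphere_zero_iff_norm.1 hc]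
    gcongr
    linarith
  · calc _ = n.factorial * (C * 2 ^ m) * (R ^ m / R ^ n) := by ring
      _ ≤ n.factorial * (C * 2 ^ m) * (1 / R) := by
        refine mul_le_mul_of_nonneg_left ?_ (by positivity)
        rw [div_le_div_iff₀ (by positivity) hR0, one_mul, ← pow_succ]
        exact pow_le_pow_right₀ hR hmn
      _ = _ := mul_one_div _ _

theorem PolyGrowth.exists_polynomial {φ : ℂ → ℂ} {m : ℕ} (hφ : PolyGrowth m φ) :
    ∃ p : Polynomial ℂ, p.degree < (m + 1 : ℕ) ∧ ∀ c, p.eval c = φ c := by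
  have hd : Differentiable ℂ φ := by simpa using hφ.entire 0 1
  obtain ⟨C, -, hC⟩ := hφ.exists_norm_le
  refine ⟨∑ n ∈ Finset.range (m + 1),
    Polynomial.monomial n ((n.factorial : ℂ)⁻¹ * iteratedDeriv n φ 0), ?_, fun c => ?_⟩
  · refine (Polynomial.degree_sum_le _ _).trans_lt ((Finset.sup_lt_iff (WithBot.bot_lt_coe _)).2
      fun n hn => (Polynomial.degree_monomial_le n _).trans_lt ?_)
    exact_mod_cast Finset.mem_range.1 hn
  · have hvanish : ∀ n ∉ Finset.range (m + 1),
        (n.factorial : ℂ)⁻¹ * iteratedDeriv n φ 0 * c ^ n = 0 := fun n hn => by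
      rw [iteratedDeriv_eq_zero_of_growth hd (by simpa using hn) hC, mul_zero, zero_mul]
    have htaylor := Complex.hasSum_taylorSeries_of_entire hd 0 c
    simp only [sub_zero, smul_eq_mul, mul_comm (c ^ _), ← mul_assoc] at htaylor
    rw [Polynomial.eval_finsetSum, ← (hasSum_sum_of_ne_finset_zero hvanish).unique htaylor]
    exact Finset.sum_congr rfl fun n _ => Polynomial.eval_monomial

theorem PolyGrowth.eq_sum_lagrange {m : ℕ} {P : E → ℂ} (hP : PolyGrowth m P) (z u : E) (c : ℂ) :
    P (z + c • u) = ∑ i ∈ Finset.range (m + 1), P (z + (i : ℂ) • u) *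
      (Lagrange.basis (Finset.range (m + 1)) (fun i : ℕ => (i : ℂ)) i).eval c := by
  obtain ⟨p, hpm, hp⟩ := (hP.comp_line z u).exists_polynomial
  have hinterp := Lagrange.eq_interpolate (s := Finset.range (m + 1)) (f := p)
    (Nat.cast_injective (R := ℂ)).injOn (by simpa using hpm)
  rw [Lagrange.interpolate_apply] at hinterp
  rw [← hp c, hinterp, Polynomial.eval_finsetSum]
  exact Finset.sum_congr rfl fun i _ => by rw [Polynomial.eval_mul, Polynomial.eval_C, hp]

end PolyGrowth

/-! ### Truncation of null sequences -/

/-- The null sequence with the first `k` entries of `x` and zeros afterwards. -/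
def truncate (k : ℕ) (x : ℕ → ℂ) : C₀(ℕ, ℂ) where
  toFun i := if i < k then x i else 0
  continuous_toFun := continuous_of_discreteTopology
  zero_at_infty' := by
    rw [cocompact_eq_cofinite, Nat.cofinite_eq_atTop]
    refine tendsto_const_nhds.congr' ?_
    filter_upwards [eventually_ge_atTop k] with i hi
    simp [hi]

@[simp] theorem truncate_apply (k : ℕ) (x : ℕ → ℂ) (i : ℕ) :
    truncate k x i = if i < k then x i else 0 := rfl

theorem truncate_succ (k : ℕ) (x : ℕ → ℂ) :
    truncate (k + 1) x = truncate k x + x k • truncate (k + 1) (Pi.single k 1) := by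
  ext i
  rcases lt_trichotomy i k with h | rfl | h
  · simp [h, h.trans (Nat.lt_succ_self k), h.ne]
  · simp
  · simp [not_lt.2 h.le, not_lt.2 (Nat.succ_le_of_lt h)]

theorem continuous_truncate (k : ℕ) : Continuous (truncate k) := by
  induction k with
  | zero => exact (continuous_const (y := 0)).congr fun x => by ext; simp
  | succ k ih =>
    exact (ih.add ((continuous_apply k).smul continuous_const)).congr fun x =>
      (truncate_succ k x).symm

theorem norm_apply_le (z : C₀(ℕ, ℂ)) (i : ℕ) : ‖z i‖ ≤ ‖z‖ := by
  simpa using z.toBCF.norm_coe_le_norm i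

theorem norm_le_iff {z : C₀(ℕ, ℂ)} {C : ℝ} (hC : 0 ≤ C) : ‖z‖ ≤ C ↔ ∀ i, ‖z i‖ ≤ C := by
  simpa using BoundedContinuousFunction.norm_le (f := z.toBCF) hC

theorem norm_truncate_le {k : ℕ} {x : ℕ → ℂ} {C : ℝ} (hC : 0 ≤ C) (h : ∀ i < k, ‖x i‖ ≤ C) :
    ‖truncate k x‖ ≤ C := by
  refine (norm_le_iff hC).2 fun i => ?_
  rw [truncate_apply]
  split_ifs with hi
  · exact h i hi
  · simpa using hC

theorem norm_truncate_le_norm (k : ℕ) (z : C₀(ℕ, ℂ)) : ‖truncate k z‖ ≤ ‖z‖ :=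
  norm_truncate_le (norm_nonneg _) fun i _ => norm_apply_le z i

theorem norm_sub_truncate_le_norm (k : ℕ) (z : C₀(ℕ, ℂ)) : ‖z - truncate k z‖ ≤ ‖z‖ :=
  (norm_le_iff (norm_nonneg _)).2 fun i => by
    rw [ZeroAtInftyContinuousMap.sub_apply, truncate_apply]
    split_ifs
    · simp
    · simpa using norm_apply_le z i

theorem tendsto_truncate (z : C₀(ℕ, ℂ)) : Tendsto (fun N => truncate N z) atTop (𝓝 z) := by
  have hz : Tendsto z atTop (𝓝 0) := by
    rw [← Nat.cofinite_eq_atTop, ← cocompact_eq_cofinite]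
    exact z.zero_at_infty'
  refine Metric.tendsto_atTop'.2 fun ε hε => ?_
  obtain ⟨N, hN⟩ := Metric.tendsto_atTop.1 hz (ε / 2) (half_pos hε)
  refine ⟨N, fun n hn => (dist_eq_norm _ _).trans_lt <| lt_of_le_of_lt
    ((norm_le_iff (half_pos hε).le).2 fun i => ?_) (half_lt_self hε)⟩
  rw [ZeroAtInftyContinuousMap.sub_apply, truncate_apply]
  split_ifs with hi
  · simpa using (half_pos hε).le
  · simpa using (hN i (hn.le.trans (not_lt.1 hi))).le

/-! ### Almost finite functions on `c₀` -/

/-- Up to a small error, the values of `P` on the closed unit ball of `c₀` depend only on finitely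
many coordinates. -/
def AlmostFinite (P : C₀(ℕ, ℂ) → ℂ) : Prop :=
  ∀ ε > 0, ∃ k, ∀ z w : C₀(ℕ, ℂ), ‖z‖ ≤ 1 → ‖w‖ ≤ 1 → (∀ i < k, z i = w i) → ‖P z - P w‖ ≤ ε

section AlmostFinite

variable {m : ℕ} {P : C₀(ℕ, ℂ) → ℂ}

theorem almostFinite_difference_of_isCompact (hP : PolyGrowth m P)
    (hdiff : ∀ u, AlmostFinite fun z => P (z + u) - P z) {S : Set C₀(ℕ, ℂ)} (hS : IsCompact S)
    {ε : ℝ} (hε : 0 < ε) :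
    ∃ k, ∀ u ∈ S, ∀ z w : C₀(ℕ, ℂ), ‖z‖ ≤ 1 → ‖w‖ ≤ 1 → (∀ i < k, z i = w i) →
      ‖(P (z + u) - P z) - (P (w + u) - P w)‖ ≤ ε := by
  refine hS.induction_on (p := fun S => ∃ k, ∀ u ∈ S, ∀ z w : C₀(ℕ, ℂ), ‖z‖ ≤ 1 → ‖w‖ ≤ 1 →
      (∀ i < k, z i = w i) → ‖(P (z + u) - P z) - (P (w + u) - P w)‖ ≤ ε)
    ⟨0, by simp⟩ (fun S T hST => Exists.imp fun k hk u hu => hk u (hST hu)) ?_ fun u _ => ?_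
  · rintro S T ⟨k, hk⟩ ⟨l, hl⟩
    refine ⟨max k l, fun u hu z w hz hw hzw => hu.elim (fun hu => ?_) fun hu => ?_⟩
    · exact hk u hu z w hz hw fun i hi => hzw i (lt_max_of_lt_left hi)
    · exact hl u hu z w hz hw fun i hi => hzw i (lt_max_of_lt_right hi)
  · obtain ⟨L, hL, hlip⟩ := hP.exists_lipschitz (‖u‖ + 2)
    obtain ⟨k, hk⟩ := hdiff u (ε / 2) (half_pos hε)
    have hδ : 0 < min 1 (ε / (4 * L)) := lt_min one_pos (by positivity)
    refine ⟨_, mem_nhdsWithin_of_mem_nhds (Metric.ball_mem_nhds u hδ), k,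
      fun v hv z w hz hw hzw => ?_⟩
    rw [mem_ball_iff_norm, lt_min_iff, lt_div_iff₀ (by positivity)] at hv
    have hv' : ‖v‖ ≤ ‖u‖ + 1 := by linarith [norm_le_norm_add_norm_sub' v u]
    have hnear : ∀ x : C₀(ℕ, ℂ), ‖x‖ ≤ 1 → ‖P (x + v) - P (x + u)‖ ≤ ε / 4 := fun x hx => by
      refine (hlip _ _ (by linarith [norm_add_le x v]) (by linarith [norm_add_le x u])).trans ?_
      rw [add_sub_add_left_eq_sub]
      linarith
    calc ‖(P (z + v) - P z) - (P (w + v) - P w)‖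
        = ‖((P (z + v) - P (z + u)) - (P (w + v) - P (w + u)))
          + ((P (z + u) - P z) - (P (w + u) - P w))‖ := by ring_nf
      _ ≤ ε / 4 + ε / 4 + ε / 2 := norm_add_le_of_le
          (norm_sub_le_of_le (hnear z hz) (hnear w hw)) (hk z w hz hw hzw)
      _ = ε := by ring

/-- The vectors of the closed unit ball of `c₀` that are finitely supported and vanish before the
index `K`. -/
def tailVectors (K : ℕ) : Set C₀(ℕ, ℂ) :=
  {w | ‖w‖ ≤ 1 ∧ (∀ i < K, w i = 0) ∧ ∃ N, ∀ i ≥ N, w i = 0}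

theorem PolyGrowth.exists_tail_value (hP : PolyGrowth m P) {ε : ℝ}
    (h : ∀ K, ∃ w ∈ tailVectors K, ε < ‖P w - P 0‖) :
    ∃ ζ : ℂ, ε ≤ ‖ζ‖ ∧ ∀ δ > 0, ∀ K, ∃ w ∈ tailVectors K, ‖P w - P 0 - ζ‖ ≤ δ := by
  choose w hw hwε using h
  obtain ⟨M, -, hM⟩ := hP.exists_norm_le_of_norm_le 1
  obtain ⟨ζ, -, φ, hφ, hlim⟩ := tendsto_subseq_of_bounded
    (Metric.isBounded_closedBall (x := (0 : ℂ)) (r := M + M)) (x := fun K => P (w K) - P 0)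
    fun K => mem_closedBall_zero_iff.2 <| norm_sub_le_of_le (hM _ (hw K).1) (hM 0 (by simp))
  refine ⟨ζ, ge_of_tendsto' hlim.norm fun n => (hwε (φ n)).le, fun δ hδ K => ?_⟩
  obtain ⟨n, hn, hnK⟩ := ((Metric.tendsto_nhds.1 hlim δ hδ).and (eventually_ge_atTop K)).exists
  refine ⟨w (φ n), ⟨(hw _).1, fun i hi => (hw _).2.1 i (hi.trans_le ?_), (hw _).2.2⟩, ?_⟩
  · exact hnK.trans (hφ.id_le n)
  · rw [← dist_eq_norm]
    exact hn.le

/-- The gliding hump: values of `P` on tail vectors add up. -/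
theorem exists_multiple_tail_value (hdiff : ∀ u, AlmostFinite fun z => P (z + u) - P z) {ζ : ℂ}
    {δ : ℝ} (hδ : 0 < δ) (hζ : ∀ K, ∃ w ∈ tailVectors K, ‖P w - P 0 - ζ‖ ≤ δ) (n : ℕ) :
    ∃ u ∈ tailVectors 0, ‖P u - P 0 - n * ζ‖ ≤ n * (2 * δ) := by
  induction n with
  | zero => exact ⟨0, ⟨by simp, by simp, 0, by simp⟩, by simp⟩
  | succ n ih =>
    obtain ⟨u, ⟨hu, -, K, hK⟩, hun⟩ := ih
    obtain ⟨k, hk⟩ := hdiff u δ hδ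
    obtain ⟨w, ⟨hw, hwK, N, hN⟩, hwζ⟩ := hζ (max K k)
    have hcross := hk w 0 hw (by simp) fun i hi => hwK i (lt_max_of_lt_right hi)
    simp only [zero_add] at hcross
    refine ⟨w + u, ⟨(norm_le_iff zero_le_one).2 fun i => ?_, by simp, max K N, fun i hi => ?_⟩, ?_⟩
    · rcases lt_or_ge i K with hi | hi
      · simpa [hwK i (lt_max_of_lt_left hi)] using (norm_apply_le u i).trans hu
      · simpa [hK i hi] using (norm_apply_le w i).trans hw
    · simp [hK i (le_of_max_le_left hi), hN i (le_of_max_le_right hi)]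
    · calc ‖P (w + u) - P 0 - (n + 1 : ℕ) * ζ‖
          = ‖((P (w + u) - P w) - (P u - P 0)) + (P w - P 0 - ζ) + (P u - P 0 - n * ζ)‖ := by
            push_cast; ring_nf
        _ ≤ δ + δ + n * (2 * δ) :=
          norm_add_le_of_le (norm_add_le_of_le hcross hwζ) hun
        _ = (n + 1 : ℕ) * (2 * δ) := by push_cast; ring

theorem PolyGrowth.exists_norm_sub_le_of_mem_tailVectors (hP : PolyGrowth m P)
    (hdiff : ∀ u, AlmostFinite fun z => P (z + u) - P z) {ε : ℝ} (hε : 0 < ε) :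
    ∃ K, ∀ w ∈ tailVectors K, ‖P w - P 0‖ ≤ ε := by
  by_contra! hfail
  obtain ⟨ζ, hζε, hζ⟩ := hP.exists_tail_value hfail
  obtain ⟨M, -, hM⟩ := hP.exists_norm_le_of_norm_le 1
  obtain ⟨n, hn⟩ := exists_nat_gt ((M + M) / (ε / 2))
  rw [div_lt_iff₀ (half_pos hε)] at hn
  obtain ⟨u, ⟨hu, -⟩, hun⟩ :=
    exists_multiple_tail_value hdiff (by positivity) (hζ (ε / 4) (by positivity)) n
  have hupper : ‖P u - P 0‖ ≤ M + M := norm_sub_le_of_le (hM u hu) (hM 0 (by simp))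
  have hlower : n * ε ≤ ‖(n : ℂ) * ζ‖ := by
    rw [norm_mul, Complex.norm_natCast]
    gcongr
  linarith [norm_le_norm_add_norm_sub (P u - P 0) (n * ζ)]

theorem PolyGrowth.exists_norm_sub_le_of_tail (hP : PolyGrowth m P)
    (hdiff : ∀ u, AlmostFinite fun z => P (z + u) - P z) {ε : ℝ} (hε : 0 < ε) :
    ∃ K, ∀ w : C₀(ℕ, ℂ), ‖w‖ ≤ 1 → (∀ i < K, w i = 0) → ‖P w - P 0‖ ≤ ε := by
  obtain ⟨K, hK⟩ := hP.exists_norm_sub_le_of_mem_tailVectors hdiff hε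
  refine ⟨K, fun w hw hwK => ?_⟩
  have hlim : Tendsto (fun N => ‖P (truncate N w) - P 0‖) atTop (𝓝 ‖P w - P 0‖) :=
    (((hP.continuous.tendsto w).comp (tendsto_truncate w)).sub_const _).norm
  exact le_of_tendsto' hlim fun N => hK _
    ⟨(norm_truncate_le_norm N w).trans hw, fun i hi => by simp [hwK i hi], N, fun i hi => by
      simp [not_lt.2 hi]⟩

/-- Split `z` and `w` into a common head `a` and tails: the head ranges over a compact set and the
values on the tails are nearly constant. -/
theorem PolyGrowth.almostFinite_of_difference (hP : PolyGrowth m P)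
    (hdiff : ∀ u, AlmostFinite fun z => P (z + u) - P z) : AlmostFinite P := by
  intro ε hε
  obtain ⟨K, hK⟩ := hP.exists_norm_sub_le_of_tail hdiff (ε := ε / 3) (by positivity)
  have hcompact : IsCompact (truncate K '' Set.univ.pi fun _ => Metric.closedBall 0 1) :=
    (isCompact_univ_pi fun _ => isCompact_closedBall _ _).image (continuous_truncate K)
  obtain ⟨k, hk⟩ := almostFinite_difference_of_isCompact hP hdiff hcompact (ε := ε / 3)
    (by positivity)
  refine ⟨max K k, fun z w hz hw hzw => ?_⟩
  have hhead : truncate K w = truncate K z := by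
    ext i
    rw [truncate_apply, truncate_apply]
    split_ifs with hi
    · rw [hzw i (lt_max_of_lt_left hi)]
    · rfl
  have htail : ∀ x : C₀(ℕ, ℂ), ‖x‖ ≤ 1 → ‖P (x - truncate K x) - P 0‖ ≤ ε / 3 := fun x hx =>
    hK _ ((norm_sub_truncate_le_norm K x).trans hx) fun i hi => by simp [hi]
  have hcross := hk (truncate K z) ⟨z, fun i _ => by simpa using (norm_apply_le z i).trans hz, rfl⟩
    (z - truncate K z) (w - truncate K z) ((norm_sub_truncate_le_norm K z).trans hz)
    (hhead ▸ (norm_sub_truncate_le_norm K w).trans hw)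
    fun i hi => by simp [hzw i (lt_max_of_lt_right hi)]
  rw [sub_add_cancel, sub_add_cancel] at hcross
  calc ‖P z - P w‖
      = ‖((P z - P (z - truncate K z)) - (P w - P (w - truncate K z)))
        + ((P (z - truncate K z) - P 0) - (P (w - truncate K z) - P 0))‖ := by ring_nf
    _ ≤ ε / 3 + (ε / 3 + ε / 3) :=
      norm_add_le_of_le hcross (norm_sub_le_of_le (htail z hz) (hhead ▸ htail w hw))
    _ = ε := by ring

theorem PolyGrowth.almostFinite (hP : PolyGrowth m P) : AlmostFinite P := by
  induction m generalizing P with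
  | zero => exact fun ε hε => ⟨0, fun z w _ _ _ => by simp [hP.eq_const z w, hε.le]⟩
  | succ m ih => exact hP.almostFinite_of_difference fun u => ih (hP.difference u)

theorem PolyGrowth.exists_mvPolynomial (hP : PolyGrowth m P) (k : ℕ) :
    ∃ p : MvPolynomial ℕ ℂ, ∀ z : ℕ → ℂ, P (truncate k z) = MvPolynomial.eval z p := by
  induction k generalizing P with
  | zero => exact ⟨MvPolynomial.C (P 0), fun z => by rw [MvPolynomial.eval_C]; congr⟩
  | succ k ih =>
    let e : C₀(ℕ, ℂ) := truncate (k + 1) (Pi.single k 1)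
    let b := Lagrange.basis (Finset.range (m + 1)) (fun i : ℕ => (i : ℂ))
    choose q hq using fun i : ℕ => ih (hP.translate ((i : ℂ) • e))
    refine ⟨∑ i ∈ Finset.range (m + 1), q i * Polynomial.aeval (MvPolynomial.X k) (b i),
      fun z => ?_⟩
    rw [truncate_succ, hP.eq_sum_lagrange, map_sum]
    refine Finset.sum_congr rfl fun i _ => ?_
    rw [map_mul, ← hq i, ← MvPolynomial.coe_aeval_eq_eval]
    change _ = _ * MvPolynomial.aeval z (Polynomial.aeval (MvPolynomial.X k) (b i))
    rw [← Polynomial.aeval_algHom_apply, MvPolynomial.aeval_X, Polynomial.coe_aeval_eq_eval]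

end AlmostFinite

/-! ### Homogeneous Taylor terms -/

section Taylor

variable {E : Type*} [NormedAddCommGroup E] [NormedSpace ℂ E]

/-- The homogeneous Taylor term of degree `l` at the origin, read off on the complex line through
`w`. -/
noncomputable def taylorTerm (F : E → ℂ) (l : ℕ) (w : E) : ℂ :=
  (l.factorial : ℂ)⁻¹ * iteratedDeriv l (fun c : ℂ => F (c • w)) 0

variable {F : E → ℂ} {M : ℝ}

theorem differentiableOn_slice (hF : DifferentiableOn ℂ F (Metric.ball 0 1)) {w : E} {r : ℝ}
    (hr : r * ‖w‖ ≤ 1) : DifferentiableOn ℂ (fun c : ℂ => F (c • w)) (Metric.ball 0 r) := by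
  refine hF.comp (differentiable_id.smul_const w).differentiableOn fun c hc => ?_
  rw [mem_ball_zero_iff] at hc ⊢
  change ‖c • w‖ < 1
  rw [norm_smul]
  rcases (norm_nonneg w).eq_or_lt with h | h
  · simp [← h]
  · nlinarith

theorem norm_taylorTerm_le_of_lt (hF : DifferentiableOn ℂ F (Metric.ball 0 1))
    (hM : ∀ z ∈ Metric.ball (0 : E) 1, ‖F z‖ ≤ M) (l : ℕ) {w : E} {b : ℝ} (hb : ‖w‖ < b) :
    ‖taylorTerm F l w‖ ≤ M * b ^ l := by
  have hb0 : 0 < b := (norm_nonneg w).trans_lt hb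
  have hbw : ∀ {c : ℂ}, ‖c‖ ≤ b⁻¹ → c • w ∈ Metric.ball (0 : E) 1 := fun {c} hc => by
    rw [mem_ball_zero_iff, norm_smul]
    exact (mul_le_mul_of_nonneg_right hc (norm_nonneg w)).trans_lt ((inv_mul_lt_one₀ hb0).2 hb)
  have hslice : DiffContOnCl ℂ (fun c : ℂ => F (c • w)) (Metric.ball 0 b⁻¹) :=
    DifferentiableOn.diffContOnCl <| by
      rw [closure_ball _ (inv_pos.2 hb0).ne']
      exact hF.comp (differentiable_id.smul_const w).differentiableOn
        fun c hc => hbw (mem_closedBall_zero_iff.1 hc)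
  have hcauchy := Complex.norm_iteratedDeriv_le_of_forall_mem_sphere_norm_le l (inv_pos.2 hb0)
    hslice fun c hc => hM _ (hbw (mem_sphere_zero_iff_norm.1 hc).le)
  rw [taylorTerm, norm_mul, norm_inv, Complex.norm_natCast, inv_mul_le_iff₀ (by positivity)]
  refine hcauchy.trans_eq ?_
  rw [inv_pow, div_inv_eq_mul, mul_assoc]

theorem norm_taylorTerm_le (hF : DifferentiableOn ℂ F (Metric.ball 0 1))
    (hM : ∀ z ∈ Metric.ball (0 : E) 1, ‖F z‖ ≤ M) (l : ℕ) (w : E) :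
    ‖taylorTerm F l w‖ ≤ M * ‖w‖ ^ l := by
  have hlim : Tendsto (fun b : ℝ => M * b ^ l) (𝓝[>] ‖w‖) (𝓝 (M * ‖w‖ ^ l)) :=
    ((continuous_const.mul (continuous_pow l)).tendsto _).mono_left nhdsWithin_le_nhds
  refine ge_of_tendsto hlim ?_
  filter_upwards [self_mem_nhdsWithin] with b hb using norm_taylorTerm_le_of_lt hF hM l hb

theorem hasSum_taylorTerm (hF : DifferentiableOn ℂ F (Metric.ball 0 1)) {w : E} {c : ℂ}
    (hc : ‖c‖ * ‖w‖ < 1) : HasSum (fun l => c ^ l * taylorTerm F l w) (F (c • w)) := by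
  obtain ⟨r, hcr, hr⟩ : ∃ r, ‖c‖ < r ∧ r * ‖w‖ ≤ 1 := by
    rcases (norm_nonneg w).eq_or_lt with h | h
    · exact ⟨‖c‖ + 1, by linarith, by simp [← h]⟩
    · exact ⟨1 / ‖w‖, by rwa [lt_div_iff₀ h], by rw [one_div_mul_cancel h.ne']⟩
  refine (Complex.hasSum_taylorSeries_on_ball (differentiableOn_slice hF hr)
    (z := c) (by simpa using hcr)).congr_fun fun l => ?_
  rw [taylorTerm, sub_zero, smul_eq_mul, smul_eq_mul, mul_left_comm]

theorem norm_sub_taylor_le (hF : DifferentiableOn ℂ F (Metric.ball 0 1))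
    (hM : ∀ z ∈ Metric.ball (0 : E) 1, ‖F z‖ ≤ M) (m : ℕ) {w : E} {c : ℂ} {t : ℝ}
    (hc : ‖c‖ * ‖w‖ ≤ t) (ht : t < 1) :
    ‖F (c • w) - ∑ l ∈ Finset.range m, c ^ l * taylorTerm F l w‖ ≤ M * t ^ m / (1 - t) := by
  have ht0 : 0 ≤ t := le_trans (by positivity) hc
  have hM0 : 0 ≤ M := (norm_nonneg _).trans (hM 0 (by simp))
  have htail := (hasSum_nat_add_iff' m).2 (hasSum_taylorTerm hF (hc.trans_lt ht))
  have hgeom : HasSum (fun l => M * t ^ m * t ^ l) (M * t ^ m * (1 - t)⁻¹) :=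
    (hasSum_geometric_of_lt_one ht0 ht).mul_left _
  rw [div_eq_mul_inv]
  refine htail.norm_le_of_bounded hgeom fun l => ?_
  rw [norm_mul, norm_pow]
  calc ‖c‖ ^ (l + m) * ‖taylorTerm F (l + m) w‖ ≤ ‖c‖ ^ (l + m) * (M * ‖w‖ ^ (l + m)) := by
        gcongr
        exact norm_taylorTerm_le hF hM _ _
    _ = M * (‖c‖ * ‖w‖) ^ (l + m) := by rw [mul_pow]; ring
    _ ≤ M * t ^ (l + m) := by gcongr
    _ = M * t ^ m * t ^ l := by rw [pow_add]; ring

theorem norm_taylorQuotient_sub_le (hF : DifferentiableOn ℂ F (Metric.ball 0 1))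
    (hM : ∀ z ∈ Metric.ball (0 : E) 1, ‖F z‖ ≤ M) (m : ℕ) {ζ : ℂ} (hζ : ζ ≠ 0) {w : E}
    (hζw : ‖ζ‖ * ‖w‖ ≤ 1 / 2) :
    ‖(ζ ^ m)⁻¹ * (F (ζ • w) - ∑ l ∈ Finset.range m, ζ ^ l * taylorTerm F l w) - taylorTerm F m w‖
      ≤ 2 * M * ‖w‖ ^ (m + 1) * ‖ζ‖ := by
  have hM0 : 0 ≤ M := (norm_nonneg _).trans (hM 0 (by simp))
  have hζm : ζ ^ m ≠ 0 := pow_ne_zero m hζ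
  have h := norm_sub_taylor_le hF hM (m + 1) le_rfl (hζw.trans_lt one_half_lt_one)
  rw [Finset.sum_range_succ, ← sub_sub] at h
  calc _ = ‖(ζ ^ m)⁻¹ * (F (ζ • w) - ∑ l ∈ Finset.range m, ζ ^ l * taylorTerm F l w
        - ζ ^ m * taylorTerm F m w)‖ := by rw [mul_sub _ _ (ζ ^ m * _), inv_mul_cancel_left₀ hζm]
    _ ≤ (‖ζ‖ ^ m)⁻¹ * (M * (‖ζ‖ * ‖w‖) ^ (m + 1) / (1 / 2)) := by
      rw [norm_mul, norm_inv, norm_pow]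
      gcongr
      refine h.trans ?_
      gcongr
      linarith
    _ = 2 * M * ‖w‖ ^ (m + 1) * ‖ζ‖ := by
      have := norm_ne_zero_iff.2 hζ
      rw [mul_pow, pow_succ ‖ζ‖]
      field_simp

theorem tendstoUniformlyOn_taylorQuotient (hF : DifferentiableOn ℂ F (Metric.ball 0 1))
    (hM : ∀ z ∈ Metric.ball (0 : E) 1, ‖F z‖ ≤ M) (m : ℕ) (R : ℝ) :
    TendstoUniformlyOn (fun (ζ : ℂ) w => (ζ ^ m)⁻¹ * (F (ζ • w) -
      ∑ l ∈ Finset.range m, ζ ^ l * taylorTerm F l w)) (taylorTerm F m) (𝓝[≠] 0)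
      (Metric.ball 0 R) := by
  have hM0 : 0 ≤ M := (norm_nonneg _).trans (hM 0 (by simp))
  have hsmall : ∀ A : ℝ, Tendsto (fun ζ : ℂ => A * ‖ζ‖) (𝓝[≠] 0) (𝓝 0) := fun A => by
    have : Continuous fun ζ : ℂ => A * ‖ζ‖ := by fun_prop
    simpa using (this.tendsto 0).mono_left nhdsWithin_le_nhds
  refine Metric.tendstoUniformlyOn_iff.2 fun ε hε => ?_
  filter_upwards [self_mem_nhdsWithin, (hsmall R).eventually_le_const one_half_pos,
    (hsmall (2 * M * R ^ (m + 1))).eventually_lt_const hε] with ζ hζ hζR hζε w hw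
  have hwR : ‖w‖ ≤ R := (mem_ball_zero_iff.1 hw).le
  rw [dist_comm, dist_eq_norm]
  refine ((norm_taylorQuotient_sub_le hF hM m hζ ?_).trans ?_).trans_lt hζε
  · rw [mul_comm]
    exact (mul_le_mul_of_nonneg_right hwR (norm_nonneg ζ)).trans hζR
  · gcongr

theorem differentiable_taylorTerm (hF : DifferentiableOn ℂ F (Metric.ball 0 1))
    (hM : ∀ z ∈ Metric.ball (0 : E) 1, ‖F z‖ ≤ M) (m : ℕ) (z u : E) :
    Differentiable ℂ fun c : ℂ => taylorTerm F m (z + c • u) := by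
  induction m using Nat.strong_induction_on with
  | _ m ih =>
  intro c₀
  let R := ‖z‖ + (‖c₀‖ + 1) * ‖u‖ + 1
  have hR : 0 < R := by positivity
  have hball : Metric.ball c₀ 1 ⊆ (fun c : ℂ => z + c • u) ⁻¹' Metric.ball 0 R := fun c hc => by
    rw [mem_ball_iff_norm] at hc
    rw [Set.mem_preimage, mem_ball_zero_iff]
    nlinarith [norm_add_le z (c • u), norm_le_norm_add_norm_sub' c c₀, norm_smul c u,
      norm_nonneg u]
  have hlim := ((tendstoUniformlyOn_taylorQuotient hF hM m R).comp fun c : ℂ => z + c • u).mono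
    hball
  refine (hlim.tendstoLocallyUniformlyOn.differentiableOn ?_ Metric.isOpen_ball).differentiableAt
    (Metric.ball_mem_nhds c₀ one_pos)
  have hζR : ∀ᶠ ζ : ℂ in 𝓝[≠] 0, ‖ζ‖ < R⁻¹ :=
    nhdsWithin_le_nhds ((continuous_norm.tendsto' 0 0 norm_zero).eventually_lt_const (inv_pos.2 hR))
  filter_upwards [hζR] with ζ hζ
  refine DifferentiableOn.const_mul (DifferentiableOn.sub ?_ ?_) _
  · refine hF.comp (Differentiable.differentiableOn (by fun_prop)) fun c hc => ?_
    rw [mem_ball_zero_iff, norm_smul]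
    calc ‖ζ‖ * ‖z + c • u‖ ≤ ‖ζ‖ * R := by
          gcongr
          exact (mem_ball_zero_iff.1 (hball hc)).le
      _ < 1 := by rwa [← lt_div_iff₀ hR, one_div]
  · exact DifferentiableOn.fun_sum fun l hl =>
      ((ih l (Finset.mem_range.1 hl)).differentiableOn).const_mul _

theorem polyGrowth_taylorTerm (hF : DifferentiableOn ℂ F (Metric.ball 0 1))
    (hM : ∀ z ∈ Metric.ball (0 : E) 1, ‖F z‖ ≤ M) (m : ℕ) : PolyGrowth m (taylorTerm F m) := by
  have hM0 : 0 ≤ M := (norm_nonneg _).trans (hM 0 (by simp))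
  refine ⟨differentiable_taylorTerm hF hM m, Asymptotics.isBigO_top.2
    ⟨M, fun z => (norm_taylorTerm_le hF hM m z).trans ?_⟩⟩
  rw [Real.norm_of_nonneg (by positivity)]
  gcongr
  linarith

theorem exists_norm_sub_smul_le (hF : UniformContinuousOn F (Metric.ball 0 1)) {ε : ℝ}
    (hε : 0 < ε) :
    ∃ r : ℝ, 0 < r ∧ r < 1 ∧ ∀ z ∈ Metric.ball (0 : E) 1, ‖F z - F ((r : ℂ) • z)‖ ≤ ε := by
  obtain ⟨δ, hδ, hFδ⟩ := Metric.uniformContinuousOn_iff_le.1 hF ε hε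
  obtain ⟨r, hr, hr1⟩ := exists_between (max_lt one_pos (sub_lt_self 1 hδ))
  obtain ⟨hr0, hrδ⟩ := max_lt_iff.1 hr
  refine ⟨r, hr0, hr1, fun z hz => ?_⟩
  have hrz : ‖(r : ℂ) • z‖ = r * ‖z‖ := by
    rw [norm_smul, Complex.norm_real, Real.norm_of_nonneg hr0.le]
  have hsub : ‖z - (r : ℂ) • z‖ = (1 - r) * ‖z‖ := by
    rw [show z - (r : ℂ) • z = ((1 - r : ℝ) : ℂ) • z by push_cast; rw [sub_smul, one_smul],
      norm_smul, Complex.norm_real, Real.norm_of_nonneg (sub_pos.2 hr1).le]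
  rw [mem_ball_zero_iff] at hz
  rw [← dist_eq_norm]
  refine hFδ z (by simpa using hz) _ ?_ ?_
  · rw [mem_ball_zero_iff, hrz]
    exact (mul_le_of_le_one_left (norm_nonneg z) hr1.le).trans_lt hz
  · rw [dist_eq_norm, hsub]
    nlinarith [norm_nonneg z]

theorem exists_polyGrowth_near (hF : DifferentiableOn ℂ F (Metric.ball 0 1))
    (hu : UniformContinuousOn F (Metric.ball 0 1))
    (hM : ∀ z ∈ Metric.ball (0 : E) 1, ‖F z‖ ≤ M) {ε : ℝ} (hε : 0 < ε) :
    ∃ (m : ℕ) (Q : E → ℂ), PolyGrowth m Q ∧ ∀ z ∈ Metric.ball (0 : E) 1, ‖F z - Q z‖ ≤ ε := by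
  obtain ⟨r, hr0, hr1, hscale⟩ := exists_norm_sub_smul_le hu (half_pos hε)
  have hlim : Tendsto (fun m : ℕ => M * r ^ m / (1 - r)) atTop (𝓝 0) := by
    simpa using ((tendsto_pow_atTop_nhds_zero_of_lt_one hr0.le hr1).const_mul M).div_const (1 - r)
  obtain ⟨m, hm⟩ := (hlim.eventually_le_const (half_pos hε)).exists
  refine ⟨m, fun z => ∑ l ∈ Finset.range m, (r : ℂ) ^ l * taylorTerm F l z,
    PolyGrowth.sum fun l hl => ((polyGrowth_taylorTerm hF hM l).mono
      (Finset.mem_range.1 hl).le).const_mul _, fun z hz => ?_⟩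
  have htaylor := (norm_sub_taylor_le hF hM m (w := z) (c := r) (by
    rw [Complex.norm_real, Real.norm_of_nonneg hr0.le]
    exact mul_le_of_le_one_right hr0.le (mem_ball_zero_iff.1 hz).le) hr1).trans hm
  calc _ ≤ _ := norm_sub_le_norm_sub_add_norm_sub _ (F ((r : ℂ) • z)) _
    _ ≤ ε / 2 + ε / 2 := add_le_add (hscale z hz) htaylor
    _ = ε := add_halves ε

end Taylor

/-! ### Uniform limits of polynomials on the ball of `c₀` -/

section UniformLimits

variable {E V ι : Type*} [NormedAddCommGroup E] [NormedSpace ℂ E] [NormedAddCommGroup V]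
  [NormedSpace ℂ V] {l : Filter ι} {G : ι → E → V} {f : E → V} {s t : Set E}

theorem uniformCauchySeqOn_fderiv {δ : ℝ} (hδ : 0 < δ) (hst : ∀ x ∈ t, Metric.ball x δ ⊆ s)
    (hG : ∀ n, DifferentiableOn ℂ (G n) s) (h : UniformCauchySeqOn G l s) :
    UniformCauchySeqOn (fun n => fderiv ℂ (G n)) l t := by
  intro u hu
  obtain ⟨ε, hε, hεu⟩ := Metric.mem_uniformity_dist.1 hu
  filter_upwards [h _ (Metric.dist_mem_uniformity (ε := ε * δ / 4) (by positivity))] with n hn x hx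
  have hdiff : ∀ i, DifferentiableAt ℂ (G i) x := fun i =>
    (hG i).differentiableAt (mem_of_superset (Metric.ball_mem_nhds x hδ) (hst x hx))
  have hmaps : Set.MapsTo (G n.1 - G n.2) (Metric.ball x δ)
      (Metric.closedBall ((G n.1 - G n.2) x) (ε / 2 * δ)) := fun y hy => by
    have hy' := hn y (hst x hx hy)
    have hx' := hn x (hst x hx (Metric.mem_ball_self hδ))
    rw [dist_eq_norm] at hy' hx'
    rw [mem_closedBall_iff_norm]
    refine (norm_sub_le _ _).trans ?_
    simp only [Pi.sub_apply]
    linarith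
  have hcauchy := Complex.norm_fderiv_le_div_of_mapsTo_ball
    (((hG n.1).sub (hG n.2)).mono (hst x hx)) hmaps hδ
  rw [mul_div_cancel_right₀ _ hδ.ne', fderiv_sub (hdiff _) (hdiff _), ← dist_eq_norm] at hcauchy
  exact hεu (hcauchy.trans_lt (half_lt_self hε))

theorem differentiableOn_of_tendstoUniformlyOn [CompleteSpace V] [NeBot l] (hs : IsOpen s)
    (hG : ∀ n, DifferentiableOn ℂ (G n) s) (h : TendstoUniformlyOn G f l s) :
    DifferentiableOn ℂ f s := by
  intro x hx
  obtain ⟨δ, hδ, hball⟩ := Metric.isOpen_iff.1 hs x hx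
  have hst : ∀ y ∈ Metric.ball x (δ / 2), Metric.ball y (δ / 2) ⊆ s := fun y hy =>
    (Metric.ball_subset_ball' (by linarith [Metric.mem_ball.1 hy])).trans hball
  have hsub : ∀ y ∈ Metric.ball x (δ / 2), y ∈ s := fun y hy =>
    hst y hy (Metric.mem_ball_self (half_pos hδ))
  have hcauchy := uniformCauchySeqOn_fderiv (half_pos hδ) hst hG h.uniformCauchySeqOn
  have hlim : ∀ y ∈ Metric.ball x (δ / 2), Tendsto (fun n => fderiv ℂ (G n) y) l
      (𝓝 (lim (map (fun n => fderiv ℂ (G n) y) l))) := fun y hy =>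
    (hcauchy.cauchy_map hy).le_nhds_lim
  exact (hasFDerivAt_of_tendstoUniformlyOn Metric.isOpen_ball
    (hcauchy.tendstoUniformlyOn_of_tendsto hlim)
    (fun n y hy => ((hG n).differentiableAt (hs.mem_nhds (hsub y hy))).hasFDerivAt)
    (fun y hy => h.tendsto_at (hsub y hy))
    (Metric.mem_ball_self (half_pos hδ))).differentiableAt.differentiableWithinAt

end UniformLimits

theorem uniformContinuous_of_isPolyLimit {X : Type*} [UniformSpace X] {u : X → Polydisc}
    (hu : UniformContinuous u) {f : X → ℂ} (hf : IsPolyLimit u f) : UniformContinuous f := by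
  refine uniformContinuous_of_uniform_approx_of_uniformContinuous fun V hV => ?_
  obtain ⟨ε, hε, hεV⟩ := Metric.mem_uniformity_dist.1 hV
  obtain ⟨p, hp⟩ := hf (ε / 2) (half_pos hε)
  refine ⟨_, (CompactSpace.uniformContinuous_of_continuous (polyMap p).continuous).comp hu,
    fun x => hεV ?_⟩
  rw [dist_eq_norm]
  exact (hp x).trans_lt (half_lt_self hε)

/-- Evaluation at a coordinate, as a continuous linear functional on `c₀`. -/
noncomputable def coordinate (i : ℕ) : C₀(ℕ, ℂ) →L[ℂ] ℂ :=
  LinearMap.mkContinuous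
    { toFun := fun z => z i, map_add' := fun _ _ => rfl, map_smul' := fun _ _ => rfl } 1
    fun z => by simpa using norm_apply_le z i

theorem differentiable_eval (p : MvPolynomial ℕ ℂ) :
    Differentiable ℂ fun z : C₀(ℕ, ℂ) => MvPolynomial.eval z p := by
  induction p using MvPolynomial.induction_on with
  | C a => simp
  | add p q hp hq => simpa only [map_add] using hp.fun_add hq
  | mul_X p i hp =>
    simp only [map_mul, MvPolynomial.eval_X]
    exact hp.fun_mul (coordinate i).differentiable

/-- The ball of `c₀` as a subset of the closed polydisc. -/
noncomputable def ballPoint (z : BallC0) : Polydisc := fun j =>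
  ⟨(z : C₀(ℕ, ℂ)) j, mem_closedBall_zero_iff.2 <|
    (norm_apply_le _ j).trans (mem_ball_zero_iff.1 z.2).le⟩

theorem polyMap_ballPoint (p : MvPolynomial ℕ ℂ) (z : BallC0) :
    polyMap p (ballPoint z) = MvPolynomial.eval (z : C₀(ℕ, ℂ)) p := polyMap_apply p _

theorem uniformContinuous_ballPoint : UniformContinuous ballPoint :=
  uniformContinuous_pi.2 fun j =>
    ((coordinate j).uniformContinuous.comp uniformContinuous_subtype_val).subtype_mk _

theorem denseRange_ballPoint : DenseRange ballPoint := by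
  intro ω
  obtain ⟨c, -, hc, hclim⟩ := exists_seq_strictMono_tendsto' (zero_lt_one' ℝ)
  have hmem : ∀ n, (c n : ℂ) • truncate n (fun j => (ω j : ℂ)) ∈ Metric.ball (0 : C₀(ℕ, ℂ)) 1 :=
    fun n => by
      rw [mem_ball_zero_iff, norm_smul]
      refine mul_lt_one_of_nonneg_of_lt_one_left (norm_nonneg _) ?_ ?_
      · rw [Complex.norm_real, Real.norm_of_nonneg (hc n).1.le]
        exact (hc n).2
      · exact norm_truncate_le zero_le_one fun i _ => mem_closedBall_zero_iff.1 (ω i).2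
  refine mem_closure_of_tendsto (f := fun n => ballPoint ⟨_, hmem n⟩) (b := atTop) ?_
    (Eventually.of_forall fun n => ⟨_, rfl⟩)
  refine tendsto_pi_nhds.2 fun j => tendsto_subtype_rng.2 ?_
  have hj : Tendsto (fun n => (c n : ℂ) * ω j) atTop (𝓝 (ω j)) := by
    simpa using ((Complex.continuous_ofReal.tendsto 1).comp hclim).mul_const (ω j : ℂ)
  refine hj.congr' ?_
  filter_upwards [eventually_gt_atTop j] with n hn
  simp [ballPoint, hn]

theorem isNorming_ballPoint : IsNorming ballPoint := isNorming_of_denseRange denseRange_ballPoint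

theorem mem_ballSubmodule_of_isPolyLimit {f : BallC0 → ℂ} (hf : IsPolyLimit ballPoint f) :
    f ∈ ballSubmodule := by
  classical
  refine ⟨uniformContinuous_of_isPolyLimit uniformContinuous_ballPoint hf,
    fun z => if hz : z ∈ Metric.ball 0 1 then f ⟨z, hz⟩ else 0, ?_, fun z => by simp⟩
  choose p hp using fun n : ℕ => hf (1 / (n + 1)) Nat.one_div_pos_of_nat
  refine differentiableOn_of_tendstoUniformlyOn
    (l := atTop) (G := fun n (z : C₀(ℕ, ℂ)) => MvPolynomial.eval z (p n)) Metric.isOpen_ball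
    (fun n => (differentiable_eval (p n)).differentiableOn)
    (Metric.tendstoUniformlyOn_iff.2 fun ε hε => ?_)
  filter_upwards [tendsto_one_div_add_atTop_nhds_zero_nat.eventually_lt_const hε] with n hn z hz
  rw [dif_pos hz, dist_eq_norm, ← polyMap_ballPoint (p n) ⟨z, hz⟩]
  exact (hp n _).trans_lt hn

theorem isPolyLimit_of_mem_ballSubmodule {f : BallC0 → ℂ} (hf : f ∈ ballSubmodule) :
    IsPolyLimit ballPoint f := by
  intro ε hε
  obtain ⟨M, hM⟩ := bounded_of_mem_ballSubmodule f hf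
  obtain ⟨hu, F, hF, hfF⟩ := hf
  have hMF : ∀ z ∈ Metric.ball (0 : C₀(ℕ, ℂ)) 1, ‖F z‖ ≤ M := fun z hz =>
    hfF ⟨z, hz⟩ ▸ hM ⟨_, rfl⟩
  have huF : UniformContinuousOn F (Metric.ball 0 1) :=
    uniformContinuousOn_iff_restrict.2 <| by
      rwa [show f = (Metric.ball 0 1).domRestrict F from funext hfF] at hu
  obtain ⟨m, Q, hQ, hFQ⟩ := exists_polyGrowth_near hF huF hMF (half_pos hε)
  obtain ⟨k, hk⟩ := hQ.almostFinite (ε / 2) (half_pos hε)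
  obtain ⟨p, hp⟩ := hQ.exists_mvPolynomial k
  refine ⟨p, fun z => ?_⟩
  have hz : ‖(z : C₀(ℕ, ℂ))‖ ≤ 1 := (mem_ball_zero_iff.1 z.2).le
  rw [polyMap_ballPoint, ← hp, hfF]
  refine (norm_sub_le_norm_sub_add_norm_sub _ (Q z) _).trans ?_
  rw [← add_halves ε]
  exact add_le_add (hFQ z z.2) (hk z _ hz ((norm_truncate_le_norm k _).trans hz)
    fun i hi => by simp [hi])

theorem mem_ballSubmodule_iff (f : BallC0 → ℂ) : f ∈ ballSubmodule ↔ IsPolyLimit ballPoint f :=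
  ⟨isPolyLimit_of_mem_ballSubmodule, mem_ballSubmodule_of_isPolyLimit⟩

/-- The polydisc algebra realised as the algebra `𝒜ᵤ(B_{c₀})`, by restriction to the ball. -/
noncomputable def ballEquiv : polydiscAlgebra ≃ₗᵢ[ℂ] BallAlgebra where
  toLinearEquiv := isNorming_ballPoint.restrictEquiv mem_ballSubmodule_iff
  norm_map' F := isNorming_ballPoint.iSup_norm_eq F.2

theorem ballEquiv_apply (F : polydiscAlgebra) (z : BallC0) :
    ballEquiv F z = (F : C(Polydisc, ℂ)) (ballPoint z) := rfl

open MeasureTheory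
open scoped FourierTransform SchwartzMap

/-! ### Dirichlet polynomials and Fourier multipliers -/

/-- A partial sum of the Dirichlet series with coefficients `a`. -/
noncomputable def dirichletSum (a : ℕ → ℂ) (N : ℕ) (s : ℂ) : ℂ :=
  ∑ n ∈ Finset.Icc 1 N, a n * (n : ℂ) ^ (-s)

theorem natCast_cpow_neg_add_vertical {n : ℕ} (hn : n ≠ 0) (s : ℂ) (t : ℝ) :
    (n : ℂ) ^ (-(s + 2 * Real.pi * t * Complex.I)) =
      𝐞 (-(t * Real.log n)) * (n : ℂ) ^ (-s) := by
  have hn' : (n : ℂ) ≠ 0 := Nat.cast_ne_zero.2 hn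
  rw [neg_add_rev, Complex.cpow_add _ _ hn', Complex.cpow_def_of_ne_zero hn' (-(_ * Complex.I)),
    ← Complex.natCast_log, Real.fourierChar_apply]
  congr 2
  push_cast
  ring

theorem integral_mul_dirichletSum {g : ℝ → ℂ} (hg : Integrable g) (a : ℕ → ℂ) (N : ℕ) (s : ℂ) :
    ∫ t : ℝ, g t * dirichletSum a N (s + 2 * Real.pi * t * Complex.I) =
      dirichletSum (fun n => a n * 𝓕 g (Real.log n)) N s := by
  have hterm : ∀ t : ℝ, g t * dirichletSum a N (s + 2 * Real.pi * t * Complex.I) =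
      ∑ n ∈ Finset.Icc 1 N, a n * (n : ℂ) ^ (-s) * 𝐞 (-(t * Real.log n)) • g t := fun t => by
    rw [dirichletSum, Finset.mul_sum]
    refine Finset.sum_congr rfl fun n hn => ?_
    rw [natCast_cpow_neg_add_vertical (Nat.one_le_iff_ne_zero.1 (Finset.mem_Icc.1 hn).1),
      Circle.smul_def, smul_eq_mul]
    ring
  simp_rw [hterm]
  rw [integral_finsetSum _ fun n _ => Integrable.const_mul (by
    simpa [mul_comm] using (Real.fourierIntegral_convergent_iff (Real.log n)).2 hg) _]
  refine Finset.sum_congr rfl fun n _ => ?_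
  rw [integral_const_mul, ← Real.fourier_real_eq, mul_right_comm]

theorem norm_dirichletSum_mul_fourier_le {g : ℝ → ℂ} (hg : Integrable g) {a : ℕ → ℂ} {N : ℕ}
    {M : ℝ} (hM : ∀ s : ℂ, 0 < s.re → ‖dirichletSum a N s‖ ≤ M) {s : ℂ} (hs : 0 < s.re) :
    ‖dirichletSum (fun n => a n * 𝓕 g (Real.log n)) N s‖ ≤ M * ∫ t, ‖g t‖ := by
  rw [← integral_mul_dirichletSum hg, ← integral_const_mul]
  refine norm_integral_le_of_norm_le (hg.norm.const_mul M) (Eventually.of_forall fun t => ?_)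
  rw [norm_mul, mul_comm]
  exact mul_le_mul_of_nonneg_right (hM _ (by simpa using hs)) (norm_nonneg _)

theorem fourier_comp_mul_left (g : ℝ → ℂ) {c : ℝ} (hc : 0 < c) (x : ℝ) :
    𝓕 (fun t => g (c * t)) x = c⁻¹ • 𝓕 g (x / c) := by
  have h := Measure.integral_comp_mul_left (fun t => 𝐞 (-(t * (x / c))) • g t) c
  rw [abs_of_pos (inv_pos.2 hc)] at h
  rw [Real.fourier_real_eq, Real.fourier_real_eq, ← h]
  refine integral_congr_ae (Eventually.of_forall fun t => ?_)
  simp only [mul_comm c t, mul_assoc, mul_div_cancel₀ x hc.ne']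

/-- A smooth cutoff function on the frequency side. -/
noncomputable def cutoff : ContDiffBump (0 : ℝ) := ⟨1 / 2, 1, by norm_num, by norm_num⟩

/-- The Schwartz function with Fourier transform `cutoff`. -/
noncomputable def kernel : 𝓢(ℝ, ℂ) :=
  𝓕⁻ ((cutoff.hasCompactSupport.comp_left Complex.ofReal_zero).toSchwartzMap
    (Complex.ofRealCLM.contDiff.comp cutoff.contDiff))

theorem fourier_kernel (x : ℝ) : 𝓕 (kernel : ℝ → ℂ) x = cutoff x := by
  rw [← SchwartzMap.fourier_coe, kernel, FourierTransform.fourier_fourierInv_eq]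
  rfl

theorem cutoff_zero : cutoff 0 = 1 :=
  cutoff.one_of_mem_closedBall (Metric.mem_closedBall_self cutoff.rIn_pos.le)

theorem cutoff_eq_zero {x : ℝ} (hx : 1 ≤ |x|) : cutoff x = 0 :=
  cutoff.zero_of_le_dist (by rwa [Real.dist_0_eq_abs])

theorem integral_kernel : ∫ t, kernel t = 1 := by
  have h := fourier_kernel 0
  rw [cutoff_zero, Complex.ofReal_one] at h
  rw [← h, Real.fourier_real_eq]
  simp

theorem integrable_kernel_comp_mul_left {c : ℝ} (hc : c ≠ 0) :
    Integrable fun t => kernel (c * t) :=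
  kernel.integrable.comp_mul_left' hc

theorem fourier_kernel_comp_mul_left {c : ℝ} (hc : 0 < c) (x : ℝ) :
    𝓕 (fun t => kernel (c * t)) x = c⁻¹ • (cutoff (x / c) : ℂ) := by
  rw [fourier_comp_mul_left _ hc, fourier_kernel]

/-! ### Truncation of Dirichlet polynomials -/

theorem norm_intervalIntegral_fourierChar_mul_le {A : ℝ} (hA : 0 ≤ A) (t : ℝ) :
    ‖∫ y in (-A)..A, (𝐞 (t * y) : ℂ)‖ ≤ 2 * A := by
  have h := intervalIntegral.norm_integral_le_of_norm_le_const (a := -A) (b := A)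
    fun y _ => (Circle.norm_coe (𝐞 (t * y))).le
  rwa [one_mul, sub_neg_eq_add, ← two_mul, abs_of_nonneg (by positivity)] at h

theorem abs_mul_norm_intervalIntegral_fourierChar_mul_le (t a b : ℝ) :
    |t| * ‖∫ y in a..b, (𝐞 (t * y) : ℂ)‖ ≤ 1 := by
  rcases eq_or_ne t 0 with rfl | ht
  · simp
  have hpi : 1 ≤ Real.pi := Real.pi_gt_three.le.trans' (by norm_num)
  set c : ℂ := 2 * Real.pi * t * Complex.I with hc_def
  have hc : c ≠ 0 := by simp [hc_def, ht, Real.pi_ne_zero]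
  have hchar : ∀ y : ℝ, (𝐞 (t * y) : ℂ) = Complex.exp (c * y) := fun y => by
    rw [Real.fourierChar_apply, hc_def]
    congr 1
    push_cast
    ring
  have hnorm : ‖c‖ = 2 * Real.pi * |t| := by
    simp [hc_def, abs_of_pos Real.pi_pos]
  have hle : ‖c‖ * ‖∫ y in a..b, (𝐞 (t * y) : ℂ)‖ ≤ 2 := by
    simp_rw [hchar]
    rw [integral_exp_mul_complex hc, norm_div, mul_div_cancel₀ _ (norm_ne_zero_iff.2 hc),
      ← hchar, ← hchar]
    refine (norm_sub_le _ _).trans ?_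
    rw [Circle.norm_coe, Circle.norm_coe]
    norm_num
  rw [hnorm] at hle
  nlinarith [mul_nonneg (abs_nonneg t) (norm_nonneg (∫ y in a..b, (𝐞 (t * y) : ℂ)))]

theorem norm_intervalIntegral_fourierChar_mul_mul_rpow_le {A δ : ℝ} (hA : 0 ≤ A) (hδ : 0 < δ)
    (hδ1 : δ < 1) (t : ℝ) :
    ‖∫ y in (-A)..A, (𝐞 (t * y) : ℂ)‖ * |t| ^ (1 - δ) ≤ (2 * A) ^ δ := by
  set b := ‖∫ y in (-A)..A, (𝐞 (t * y) : ℂ)‖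
  have hb : 0 ≤ b := norm_nonneg _
  have hbA : b ^ δ ≤ (2 * A) ^ δ :=
    Real.rpow_le_rpow hb (norm_intervalIntegral_fourierChar_mul_le hA t) hδ.le
  have htb : (|t| * b) ^ (1 - δ) ≤ 1 := Real.rpow_le_one (by positivity)
    (abs_mul_norm_intervalIntegral_fourierChar_mul_le t _ _) (by linarith)
  calc b * |t| ^ (1 - δ) = b ^ δ * (|t| * b) ^ (1 - δ) := by
        rw [Real.mul_rpow (abs_nonneg t) hb, mul_left_comm,
          ← Real.rpow_add' hb (by norm_num), add_sub_cancel, Real.rpow_one, mul_comm]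
    _ ≤ (2 * A) ^ δ * 1 := by gcongr
    _ = (2 * A) ^ δ := mul_one _

theorem fourier_mul_intervalIntegral_fourierChar {g : ℝ → ℂ} (hg : Integrable g) (A x : ℝ) :
    𝓕 (fun t => g t * ∫ y in (-A)..A, (𝐞 (t * y) : ℂ)) x = ∫ u in (x - A)..(x + A), 𝓕 g u := by
  have hint : Integrable (Function.uncurry fun y t : ℝ => g t * (𝐞 (-(t * (x - y))) : ℂ))
      ((volume.restrict (Set.uIoc (-A) A)).prod volume) := by
    have : IsFiniteMeasure (volume.restrict (Set.uIoc (-A) A)) :=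
      inferInstanceAs (IsFiniteMeasure (volume.restrict (Set.Ioc _ _)))
    have h := (integrable_const (1 : ℂ) (μ := volume.restrict (Set.uIoc (-A) A))).mul_prod hg
    simp only [one_mul] at h
    exact h.mul_bdd (c := 1) (Continuous.aestronglyMeasurable (by fun_prop))
      (Eventually.of_forall fun z => (Circle.norm_coe _).le)
  have hsub := intervalIntegral.integral_comp_sub_left (a := -A) (b := A) (𝓕 g) x
  rw [sub_neg_eq_add] at hsub
  rw [← hsub, Real.fourier_real_eq]
  simp_rw [Real.fourier_real_eq, Circle.smul_def, smul_eq_mul, mul_comm _ (g _)]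
  rw [intervalIntegral_integral_swap hint]
  refine integral_congr_ae (Eventually.of_forall fun t => ?_)
  simp only
  rw [mul_left_comm, intervalIntegral.integral_const_mul, ← intervalIntegral.integral_const_mul]
  congr 2
  ext y
  rw [← Circle.coe_mul, ← AddChar.map_add_eq_mul]
  congr 2
  ring

theorem integrable_norm_mul_abs_rpow {V : Type*} [NormedAddCommGroup V] [NormedSpace ℝ V]
    (f : 𝓢(ℝ, V)) {α : ℝ} (hα : 0 ≤ α) (hα1 : α < 1) :
    Integrable fun t => ‖f t‖ * |t| ^ (-α) := by
  have hmeas : AEStronglyMeasurable fun t => ‖f t‖ * |t| ^ (-α) :=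
    f.continuous.norm.aestronglyMeasurable.mul
      (measurable_norm.pow_const _).aestronglyMeasurable
  obtain ⟨C, -, hC⟩ := f.decay 0 0
  simp only [pow_zero, norm_iteratedFDeriv_zero, one_mul] at hC
  rw [← integrableOn_univ, ← Set.union_compl_self (Metric.ball (0 : ℝ) 1)]
  refine IntegrableOn.union ?_ (f.integrable.norm.integrableOn.mono' hmeas.restrict ?_)
  · refine integrableOn_ball_of_norm_le_rpow (C := C) (α := α) (by simp) (by simpa)
      (Eventually.of_forall fun t => ?_) hmeas
    rw [Real.norm_of_nonneg (by positivity), Real.norm_eq_abs]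
    gcongr
    exact hC t
  · filter_upwards [ae_restrict_mem Metric.isOpen_ball.measurableSet.compl] with t ht
    have ht1 : 1 ≤ |t| := by simpa using ht
    rw [Real.norm_of_nonneg (by positivity)]
    exact mul_le_of_le_one_right (norm_nonneg _)
      (Real.rpow_le_one_of_one_le_of_nonpos ht1 (by linarith))

/-- A function whose Fourier transform is `c` times a smooth cutoff function that is `1` for
`|x| ≤ A - η` and `0` for `|x| ≥ A + η`, with `c = ∫ x, cutoff x`. -/
noncomputable def truncationKernel (A η t : ℝ) : ℂ :=
  kernel (η * t) * ∫ y in (-A)..A, (𝐞 (t * y) : ℂ)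

theorem integrable_truncationKernel {A η : ℝ} (hA : 0 ≤ A) (hη : 0 < η) :
    Integrable (truncationKernel A η) :=
  (integrable_kernel_comp_mul_left hη.ne').mul_bdd (c := 2 * A)
    (intervalIntegral.continuous_parametric_intervalIntegral_of_continuous' (by fun_prop) _ _
      |>.aestronglyMeasurable)
    (Eventually.of_forall (norm_intervalIntegral_fourierChar_mul_le hA))

theorem fourier_truncationKernel {η : ℝ} (hη : 0 < η) (A x : ℝ) :
    𝓕 (truncationKernel A η) x = ∫ u in ((x - A) / η)..((x + A) / η), (cutoff u : ℂ) := by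
  have h := intervalIntegral.integral_comp_div (a := x - A) (b := x + A)
    (fun u => (cutoff u : ℂ)) hη.ne'
  unfold truncationKernel
  rw [fourier_mul_intervalIntegral_fourierChar (integrable_kernel_comp_mul_left hη.ne')]
  simp_rw [fourier_kernel_comp_mul_left hη]
  rw [intervalIntegral.integral_smul, h, inv_smul_smul₀ hη.ne']

theorem fourier_truncationKernel_eq_integral {A η x : ℝ} (hη : 0 < η) (hx : |x| ≤ A - η) :
    𝓕 (truncationKernel A η) x = ∫ u, (cutoff u : ℂ) := by
  obtain ⟨hl, hr⟩ := abs_le.1 hx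
  rw [fourier_truncationKernel hη]
  refine intervalIntegral.integral_eq_integral_of_support_subset fun u hu => ?_
  have hu1 : |u| < 1 := by
    by_contra! h
    exact hu (congrArg Complex.ofReal (cutoff_eq_zero h))
  obtain ⟨hul, hur⟩ := abs_lt.1 hu1
  exact ⟨(div_le_iff₀ hη).2 (by linarith) |>.trans_lt hul,
    hur.le.trans ((le_div_iff₀ hη).2 (by linarith))⟩

theorem fourier_truncationKernel_eq_zero {A η x : ℝ} (hA : 0 ≤ A) (hη : 0 < η) (hx : A + η ≤ x) :
    𝓕 (truncationKernel A η) x = 0 := by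
  rw [fourier_truncationKernel hη, intervalIntegral.integral_of_le (by gcongr; linarith)]
  refine setIntegral_eq_zero_of_forall_eq_zero fun u hu => ?_
  have hu1 : 1 ≤ u := ((le_div_iff₀ hη).2 (by linarith)).trans hu.1.le
  rw [cutoff_eq_zero (hu1.trans (le_abs_self u)), Complex.ofReal_zero]

theorem exists_integral_norm_truncationKernel_le {δ : ℝ} (hδ : 0 < δ) (hδ1 : δ < 1) :
    ∃ C, 0 ≤ C ∧ ∀ A η : ℝ, 0 ≤ A → 0 < η →
      ∫ t, ‖truncationKernel A η t‖ ≤ C * (A / η) ^ δ := by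
  have hint := integrable_norm_mul_abs_rpow kernel (sub_nonneg.2 hδ1.le) (by linarith)
  refine ⟨2 ^ δ * ∫ u, ‖kernel u‖ * |u| ^ (-(1 - δ)), mul_nonneg (by positivity)
    (integral_nonneg fun _ => by positivity), fun A η hA hη => ?_⟩
  have hscale := Measure.integral_comp_mul_left (fun u => ‖kernel u‖ * |u| ^ (-(1 - δ))) η
  have hbound : ∀ᵐ t : ℝ, ‖truncationKernel A η t‖ ≤
      (2 * A) ^ δ * η ^ (1 - δ) * (‖kernel (η * t)‖ * |η * t| ^ (-(1 - δ))) := by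
    filter_upwards [Measure.ae_ne volume 0] with t ht
    have ht0 : 0 < |t| := abs_pos.2 ht
    rw [truncationKernel, norm_mul, abs_mul, abs_of_pos hη, Real.mul_rpow hη.le ht0.le,
      Real.rpow_neg hη.le, Real.rpow_neg ht0.le]
    have h := norm_intervalIntegral_fourierChar_mul_mul_rpow_le hA hδ hδ1 t
    rw [← le_div_iff₀ (by positivity)] at h
    calc _ ≤ ‖kernel (η * t)‖ * ((2 * A) ^ δ / |t| ^ (1 - δ)) := by gcongr
      _ = _ := by field_simp
  refine (integral_mono_ae (integrable_truncationKernel hA hη).norm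
    ((hint.comp_mul_left' hη.ne').const_mul _) hbound).trans_eq ?_
  rw [integral_const_mul, hscale, abs_of_pos (inv_pos.2 hη), smul_eq_mul, Real.div_rpow hA hη.le,
    Real.mul_rpow zero_le_two hA, Real.rpow_sub hη, Real.rpow_one]
  field_simp

theorem dirichletSum_mul_fourier_truncationKernel (a : ℕ → ℂ) {L N : ℕ} (hL : 0 < L) (hLN : L ≤ N)
    {A η : ℝ} (hA : 0 ≤ A) (hη : 0 < η) (hAL : Real.log L = A - η)
    (hAL' : Real.log (L + 1) = A + η) (s : ℂ) :
    dirichletSum (fun n => a n * 𝓕 (truncationKernel A η) (Real.log n)) N s =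
      (∫ u, (cutoff u : ℂ)) * dirichletSum a L s := by
  simp only [dirichletSum]
  rw [Finset.mul_sum, ← Finset.sum_subset (Finset.Icc_subset_Icc_right hLN)]
  · refine Finset.sum_congr rfl fun n hn => ?_
    obtain ⟨hn1, hnL⟩ := Finset.mem_Icc.1 hn
    have hlog : Real.log n ≤ Real.log L := by gcongr
    rw [fourier_truncationKernel_eq_integral hη]
    · ring
    · rwa [abs_of_nonneg (Real.log_natCast_nonneg n), ← hAL]
  · intro n hn hnL
    have hLn : L + 1 ≤ n := by
      simp only [Finset.mem_Icc] at hn hnL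
      omega
    have hlog : Real.log (L + 1) ≤ Real.log n := Real.log_le_log (by positivity) (mod_cast hLn)
    rw [fourier_truncationKernel_eq_zero hA hη (hAL' ▸ hlog), mul_zero, zero_mul]

theorem one_div_add_one_le_log_sub_log {x : ℝ} (hx : 0 < x) :
    1 / (x + 1) ≤ Real.log (x + 1) - Real.log x := by
  rw [← Real.log_div (by positivity) hx.ne']
  refine le_trans (le_of_eq ?_) (Real.one_sub_inv_le_log_of_pos (by positivity))
  field_simp
  ring

theorem log_add_log_div_log_sub_log_le {x : ℝ} (hx : 1 ≤ x) :
    (Real.log (x + 1) + Real.log x) / (Real.log (x + 1) - Real.log x) ≤ (2 * x) ^ 2 := by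
  have hx0 : 0 < x := by linarith
  have hgap := one_div_add_one_le_log_sub_log hx0
  have hgap' : 1 / (2 * x) ≤ 1 / (x + 1) := by gcongr; linarith
  have : 0 < 1 / (2 * x) := by positivity
  have hlog := Real.log_le_sub_one_of_pos hx0
  have hlog' := Real.log_le_sub_one_of_pos (by positivity : 0 < x + 1)
  calc _ ≤ 2 * x / (1 / (2 * x)) := by gcongr <;> linarith
    _ = (2 * x) ^ 2 := by field_simp

/-- Smoothing the truncation at `L` on the scale of the gap between `log L` and `log (L + 1)`
leaves the partial sum unchanged, and costs only the `L¹` norm of the truncation kernel. -/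
theorem exists_norm_dirichletSum_le_rpow {δ : ℝ} (hδ : 0 < δ) (hδ2 : δ < 2) :
    ∃ C, 0 ≤ C ∧ ∀ (a : ℕ → ℂ) (N : ℕ) (M : ℝ), (∀ s : ℂ, 0 < s.re → ‖dirichletSum a N s‖ ≤ M) →
      ∀ L ≤ N, ∀ s : ℂ, 0 < s.re → ‖dirichletSum a L s‖ ≤ C * M * (L : ℝ) ^ δ := by
  obtain ⟨C, hC0, hC⟩ := exists_integral_norm_truncationKernel_le (half_pos hδ) (by linarith)
  set c := ∫ u, (cutoff u : ℂ) with hc_def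
  have hc : 0 < ‖c‖ := by
    rw [hc_def, integral_complex_ofReal]
    exact norm_pos_iff.2 (Complex.ofReal_ne_zero.2 cutoff.integral_pos.ne')
  refine ⟨C * 2 ^ δ / ‖c‖, by positivity, fun a N M hM L hLN s hs => ?_⟩
  have hM0 : 0 ≤ M := (norm_nonneg _).trans (hM s hs)
  rcases L.eq_zero_or_pos with rfl | hL
  · simp [dirichletSum, Real.zero_rpow hδ.ne']
  have hL1 : (1 : ℝ) ≤ L := mod_cast hL
  have hgap := one_div_add_one_le_log_sub_log (zero_lt_one.trans_le hL1)
  have hgap_pos : 0 < 1 / ((L : ℝ) + 1) := by positivity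
  set A := (Real.log (L + 1) + Real.log L) / 2 with hA_def
  set η := (Real.log (L + 1) - Real.log L) / 2 with hη_def
  have hη : 0 < η := by linarith
  have hA : 0 ≤ A := by linarith [Real.log_nonneg hL1]
  have hratio : (A / η) ^ (δ / 2) ≤ 2 ^ δ * (L : ℝ) ^ δ := by
    rw [hA_def, hη_def, div_div_div_cancel_right₀ two_ne_zero]
    refine (Real.rpow_le_rpow (div_nonneg (by linarith) (by linarith))
      (log_add_log_div_log_sub_log_le hL1) (by positivity)).trans_eq ?_
    rw [← Real.rpow_natCast, ← Real.rpow_mul (by positivity), Nat.cast_ofNat,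
      mul_div_cancel₀ δ two_ne_zero, Real.mul_rpow zero_le_two L.cast_nonneg]
  have h := norm_dirichletSum_mul_fourier_le (integrable_truncationKernel hA hη) hM hs
  rw [dirichletSum_mul_fourier_truncationKernel a hL hLN hA hη (by rw [hA_def, hη_def]; ring)
    (by rw [hA_def, hη_def]; ring), norm_mul] at h
  rw [div_mul_eq_mul_div, div_mul_eq_mul_div, le_div_iff₀ hc, mul_comm]
  calc _ ≤ M * (C * (A / η) ^ (δ / 2)) := h.trans (by gcongr; exact hC A η hA hη)
    _ ≤ M * (C * (2 ^ δ * (L : ℝ) ^ δ)) := by gcongr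
    _ = _ := by ring

/-! ### Summation by parts -/

theorem dirichletSum_add (a : ℕ → ℂ) (N : ℕ) (z w : ℂ) :
    dirichletSum a N (z + w) = dirichletSum a N z * ((N + 1 : ℕ) : ℂ) ^ (-w) +
      ∑ n ∈ Finset.Icc 1 N,
        dirichletSum a n z * ((n : ℂ) ^ (-w) - ((n + 1 : ℕ) : ℂ) ^ (-w)) := by
  induction N with
  | zero => simp [dirichletSum]
  | succ N ih =>
    have hsucc : ∀ s : ℂ, dirichletSum a (N + 1) s =
        dirichletSum a N s + a (N + 1) * ((N + 1 : ℕ) : ℂ) ^ (-s) := fun s =>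
      Finset.sum_Icc_succ_top (by omega) _
    rw [hsucc, ih, Finset.sum_Icc_succ_top (by omega), hsucc z, neg_add,
      Complex.cpow_add _ _ (Nat.cast_ne_zero.2 N.succ_ne_zero)]
    ring

theorem norm_cpow_sub_cpow_succ_le {w : ℂ} (hw : 0 < w.re) {n : ℕ} (hn : 0 < n) :
    ‖(n : ℂ) ^ (-w) - ((n + 1 : ℕ) : ℂ) ^ (-w)‖ ≤ ‖w‖ * (n : ℝ) ^ (-w.re - 1) := by
  have hn0 : (0 : ℝ) < n := Nat.cast_pos.2 hn
  have hw0 : -w ≠ 0 := neg_ne_zero.2 (ne_of_apply_ne Complex.re hw.ne')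
  have h := Convex.norm_image_sub_le_of_norm_hasDerivWithin_le (s := Set.Icc (n : ℝ) (n + 1))
    (f := fun y : ℝ => (y : ℂ) ^ (-w)) (f' := fun y : ℝ => -w * (y : ℂ) ^ (-w - 1))
    (C := ‖w‖ * (n : ℝ) ^ (-w.re - 1)) (x := n + 1) (y := n)
    (fun x hx => (hasDerivAt_ofReal_cpow_const (hn0.trans_le hx.1).ne' hw0).hasDerivWithinAt)
    (fun x hx => by
      rw [norm_mul, norm_neg, Complex.norm_cpow_eq_rpow_re_of_pos (hn0.trans_le hx.1),
        Complex.sub_re, Complex.neg_re, Complex.one_re]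
      gcongr ‖w‖ * ?_
      exact Real.rpow_le_rpow_of_nonpos hn0 hx.1 (by linarith))
    (convex_Icc _ _) (by simp) (by simp)
  simpa using h

theorem norm_dirichletSum_add_le {a : ℕ → ℂ} {N : ℕ} {B δ : ℝ} {z w : ℂ} (hB0 : 0 ≤ B)
    (hδ : 0 ≤ δ) (hB : ∀ n ≤ N, ‖dirichletSum a n z‖ ≤ B * (n : ℝ) ^ δ) (hw : δ < w.re) :
    ‖dirichletSum a N (z + w)‖ ≤ B * (1 + ‖w‖ * ∑' n : ℕ, (n : ℝ) ^ (δ - w.re - 1)) := by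
  have hsum : Summable fun n : ℕ => (n : ℝ) ^ (δ - w.re - 1) :=
    Real.summable_nat_rpow.2 (by linarith)
  have hboundary : ‖dirichletSum a N z * ((N + 1 : ℕ) : ℂ) ^ (-w)‖ ≤ B := by
    have hN : (0 : ℝ) < (N + 1 : ℕ) := Nat.cast_pos.2 N.succ_pos
    rw [norm_mul, Complex.norm_natCast_cpow_of_pos N.succ_pos, Complex.neg_re]
    calc _ ≤ B * ((N + 1 : ℕ) : ℝ) ^ δ * ((N + 1 : ℕ) : ℝ) ^ (-w.re) := by
          gcongr
          exact (hB N le_rfl).trans (by gcongr; simp)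
      _ = B * ((N + 1 : ℕ) : ℝ) ^ (δ - w.re) := by
          rw [mul_assoc, ← Real.rpow_add hN, sub_eq_add_neg]
      _ ≤ B := mul_le_of_le_one_right hB0
          (Real.rpow_le_one_of_one_le_of_nonpos (mod_cast N.succ_pos) (by linarith))
  have hterm : ∀ n ∈ Finset.Icc 1 N,
      ‖dirichletSum a n z * ((n : ℂ) ^ (-w) - ((n + 1 : ℕ) : ℂ) ^ (-w))‖ ≤
        B * ‖w‖ * (n : ℝ) ^ (δ - w.re - 1) := fun n hn => by
    obtain ⟨hn1, hnN⟩ := Finset.mem_Icc.1 hn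
    rw [norm_mul]
    calc _ ≤ B * (n : ℝ) ^ δ * (‖w‖ * (n : ℝ) ^ (-w.re - 1)) := by
          gcongr
          · exact hB n hnN
          · exact norm_cpow_sub_cpow_succ_le (hδ.trans_lt hw) hn1
      _ = B * ‖w‖ * ((n : ℝ) ^ δ * (n : ℝ) ^ (-w.re - 1)) := by ring
      _ = _ := by
          rw [← Real.rpow_add (Nat.cast_pos.2 hn1)]
          ring_nf
  rw [dirichletSum_add, mul_add, mul_one]
  refine norm_add_le_of_le hboundary ((norm_sum_le_of_le _ hterm).trans ?_)
  rw [← Finset.mul_sum, ← mul_assoc]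
  gcongr
  exact hsum.sum_le_tsum _ fun n _ => by positivity

theorem exists_norm_dirichletSum_le {s : ℂ} (hs : 0 < s.re) :
    ∃ C, 0 ≤ C ∧ ∀ (a : ℕ → ℂ) (N : ℕ) (M : ℝ), (∀ s : ℂ, 0 < s.re → ‖dirichletSum a N s‖ ≤ M) →
      ∀ L ≤ N, ‖dirichletSum a L s‖ ≤ C * M := by
  have hs2 : (s / 2).re = s.re / 2 := by simp
  set δ := min 1 (s.re / 4)
  have hδ : 0 < δ := lt_min one_pos (by positivity)
  have hδ1 : δ ≤ 1 := min_le_left _ _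
  have hδs : δ < (s / 2).re := (min_le_right _ _).trans_lt (by linarith)
  obtain ⟨C, hC0, hC⟩ := exists_norm_dirichletSum_le_rpow hδ (by linarith)
  refine ⟨C * (1 + ‖s / 2‖ * ∑' n : ℕ, (n : ℝ) ^ (δ - (s / 2).re - 1)), by positivity,
    fun a N M hM L hL => ?_⟩
  have hM0 : 0 ≤ M := (norm_nonneg _).trans (hM s hs)
  have h := norm_dirichletSum_add_le (mul_nonneg hC0 hM0) hδ.le
    (fun n hn => hC a N M hM n (hn.trans hL) (s / 2) (hδ.trans hδs)) hδs
  rw [add_halves] at h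
  exact h.trans_eq (mul_right_comm _ _ _)

theorem exists_norm_coeff_le {s : ℂ} (hs : 0 < s.re) :
    ∃ C, 0 ≤ C ∧ ∀ (a : ℕ → ℂ) (N : ℕ) (M : ℝ), (∀ s : ℂ, 0 < s.re → ‖dirichletSum a N s‖ ≤ M) →
      ∀ n ∈ Finset.Icc 1 N, ‖a n * (n : ℂ) ^ (-s)‖ ≤ C * M := by
  obtain ⟨C, hC0, hC⟩ := exists_norm_dirichletSum_le hs
  refine ⟨C + C, by positivity, fun a N M hM n hn => ?_⟩
  obtain ⟨hn1, hnN⟩ := Finset.mem_Icc.1 hn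
  obtain ⟨m, rfl⟩ : ∃ m, n = m + 1 := ⟨n - 1, by omega⟩
  have hsub : a (m + 1) * ((m + 1 : ℕ) : ℂ) ^ (-s) =
      dirichletSum a (m + 1) s - dirichletSum a m s :=
    eq_sub_of_add_eq' (Finset.sum_Icc_succ_top hn1 _).symm
  rw [hsub, add_mul]
  exact norm_sub_le_of_le (hC a N M hM _ hnN) (hC a N M hM _ (by omega))

/-! ### Bohr's correspondence -/

theorem nth_prime (j : ℕ) : (Nat.nth Nat.Prime j).Prime :=
  Nat.nth_mem_of_infinite Nat.infinite_setOfPred_prime j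

theorem nth_prime_injective : Function.Injective (Nat.nth Nat.Prime) :=
  Nat.nth_injective Nat.infinite_setOfPred_prime

theorem primePow_ne_zero (d : ℕ →₀ ℕ) : primePow d ≠ 0 :=
  Finset.prod_ne_zero_iff.2 fun j _ => pow_ne_zero _ (nth_prime j).ne_zero

theorem primePow_eq_prod_mapDomain (d : ℕ →₀ ℕ) :
    primePow d = (d.mapDomain (Nat.nth Nat.Prime)).prod fun p k => p ^ k :=
  (Finsupp.prod_mapDomain_index_inj nth_prime_injective).symm

theorem factorization_primePow (d : ℕ →₀ ℕ) :
    (primePow d).factorization = d.mapDomain (Nat.nth Nat.Prime) := by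
  rw [primePow_eq_prod_mapDomain]
  refine Nat.prod_pow_factorization_eq_self fun p hp => ?_
  obtain ⟨j, -, rfl⟩ := Finset.mem_image.1 (Finsupp.mapDomain_support hp)
  exact nth_prime j

/-- The multi-index `α` with `p ^ α = n`. -/
noncomputable def exponents (n : ℕ) : ℕ →₀ ℕ :=
  n.factorization.comapDomain (Nat.nth Nat.Prime) nth_prime_injective.injOn

theorem exponents_primePow (d : ℕ →₀ ℕ) : exponents (primePow d) = d := by
  ext j
  rw [exponents, Finsupp.comapDomain_apply, factorization_primePow,
    Finsupp.mapDomain_apply nth_prime_injective]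

theorem primePow_injective : Function.Injective primePow :=
  Function.LeftInverse.injective exponents_primePow

theorem primePow_exponents {n : ℕ} (hn : n ≠ 0) : primePow (exponents n) = n := by
  rw [primePow_eq_prod_mapDomain, exponents, Finsupp.mapDomain_comapDomain _ nth_prime_injective]
  · exact Nat.prod_factorization_pow_eq_self hn
  · rw [Nat.range_nth_of_infinite Nat.infinite_setOfPred_prime]
    exact fun p hp => Nat.prime_of_mem_primeFactors hp

theorem primePow_mem_factoredNumbers {d : ℕ →₀ ℕ} {S : Finset ℕ} (hd : d.support ⊆ S) :
    primePow d ∈ Nat.factoredNumbers (S.image (Nat.nth Nat.Prime)) := by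
  refine Nat.mem_factoredNumbers_of_primeFactors_subset (primePow_ne_zero d) ?_
  rw [← Nat.support_factorization, factorization_primePow]
  exact Finsupp.mapDomain_support.trans (Finset.image_subset_image hd)

theorem HalfPlane.ne_zero (s : HalfPlane) : (s : ℂ) ≠ 0 := ne_of_apply_ne Complex.re s.2.ne'

theorem norm_prime_cpow_neg_lt_one (s : HalfPlane) {p : ℕ} (hp : p.Prime) :
    ‖(p : ℂ) ^ (-(s : ℂ))‖ < 1 := by
  rw [Complex.norm_natCast_cpow_of_pos hp.pos]
  exact Real.rpow_lt_one_of_one_lt_of_neg (mod_cast hp.one_lt) (neg_neg_of_pos s.2)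

/-- The half-plane as a subset of the closed polydisc: Bohr's point `(p_j ^ (-s))_j`. -/
noncomputable def primePoint (s : HalfPlane) : Polydisc := fun j =>
  ⟨(Nat.nth Nat.Prime j : ℂ) ^ (-(s : ℂ)),
    mem_closedBall_zero_iff.2 (norm_prime_cpow_neg_lt_one s (nth_prime j)).le⟩

theorem prod_primePoint_pow (s : HalfPlane) (d : ℕ →₀ ℕ) :
    (d.prod fun j k => (primePoint s j : ℂ) ^ k) = (primePow d : ℂ) ^ (-(s : ℂ)) := by
  have h := map_finsuppProd (riemannZetaSummandHom s.ne_zero) d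
    fun j k => Nat.nth Nat.Prime j ^ k
  simp only [map_pow] at h
  exact h.symm

theorem polyMap_monomial (d : ℕ →₀ ℕ) (c : ℂ) (ω : Polydisc) :
    polyMap (MvPolynomial.monomial d c) ω = c * d.prod fun j k => (ω j : ℂ) ^ k := by
  rw [polyMap_apply, MvPolynomial.eval_monomial]

theorem polyMap_monomial_primePoint (d : ℕ →₀ ℕ) (c : ℂ) (s : HalfPlane) :
    polyMap (MvPolynomial.monomial d c) (primePoint s) = c * (primePow d : ℂ) ^ (-(s : ℂ)) := by
  rw [polyMap_monomial, prod_primePoint_pow]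

theorem polyMap_eq_sum (p : MvPolynomial ℕ ℂ) (ω : Polydisc) :
    polyMap p ω = ∑ d ∈ p.support, p.coeff d * d.prod fun j k => (ω j : ℂ) ^ k := by
  rw [polyMap_apply, MvPolynomial.eval_eq]
  rfl

theorem uniformContinuous_natCast_cpow_neg {p : ℕ} (hp : p.Prime) :
    UniformContinuous fun s : HalfPlane => (p : ℂ) ^ (-(s : ℂ)) := by
  have hderiv : ∀ s : ℂ, HasDerivAt (fun s : ℂ => (p : ℂ) ^ (-s))
      ((p : ℂ) ^ (-s) * Complex.log p * -1) s := fun s =>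
    (hasDerivAt_neg s).const_cpow (Or.inl (Nat.cast_ne_zero.2 hp.ne_zero))
  refine (LipschitzWith.of_dist_le' (K := ‖Complex.log p‖) fun s t => ?_).uniformContinuous
  rw [dist_eq_norm, Subtype.dist_eq, dist_eq_norm]
  refine (convex_halfSpace_re_gt 0).norm_image_sub_le_of_norm_hasDerivWithin_le
    (fun x _ => (hderiv x).hasDerivWithinAt) (fun x hx => ?_) t.2 s.2
  rw [norm_mul, norm_mul, norm_neg, norm_one, mul_one]
  exact mul_le_of_le_one_left (norm_nonneg _) (norm_prime_cpow_neg_lt_one ⟨x, hx⟩ hp).le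

theorem uniformContinuous_primePoint : UniformContinuous primePoint :=
  uniformContinuous_pi.2 fun j =>
    (uniformContinuous_natCast_cpow_neg (nth_prime j)).subtype_mk _

/-- The `n`-th coefficient of the Dirichlet polynomial corresponding to a polynomial. -/
noncomputable def dirichletCoeff (p : MvPolynomial ℕ ℂ) (n : ℕ) : ℂ := p.coeff (exponents n)

theorem dirichletCoeff_primePow (p : MvPolynomial ℕ ℂ) (d : ℕ →₀ ℕ) :
    dirichletCoeff p (primePow d) = p.coeff d := by
  rw [dirichletCoeff, exponents_primePow]

theorem exists_polyMap_primePoint_eq (p : MvPolynomial ℕ ℂ) : ∃ N₀, ∀ N ≥ N₀, ∀ s : HalfPlane,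
    polyMap p (primePoint s) = dirichletSum (dirichletCoeff p) N s := by
  refine ⟨p.support.sup primePow, fun N hN s => ?_⟩
  have hsum : polyMap p (primePoint s) =
      ∑ n ∈ p.support.image primePow, dirichletCoeff p n * (n : ℂ) ^ (-(s : ℂ)) := by
    rw [Finset.sum_image primePow_injective.injOn, polyMap_eq_sum]
    simp only [prod_primePoint_pow, dirichletCoeff_primePow]
  rw [hsum]
  refine Finset.sum_subset (fun n hn => ?_) fun n hn hnp => ?_
  · obtain ⟨d, hd, rfl⟩ := Finset.mem_image.1 hn
    exact Finset.mem_Icc.2 ⟨Nat.pos_of_ne_zero (primePow_ne_zero d),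
      (Finset.le_sup (f := primePow) hd).trans hN⟩
  · rw [dirichletCoeff, MvPolynomial.notMem_support_iff.1, zero_mul]
    exact fun hmem => hnp (Finset.mem_image.2
      ⟨_, hmem, primePow_exponents (Nat.pos_iff_ne_zero.1 (Finset.mem_Icc.1 hn).1)⟩)

/-- The polynomial whose restriction to the half-plane is `∑ n ∈ Icc 1 N, a n * n ^ (-s)`. -/
noncomputable def bohrPoly (a : ℕ → ℂ) (N : ℕ) : MvPolynomial ℕ ℂ :=
  ∑ n ∈ Finset.Icc 1 N, MvPolynomial.monomial (exponents n) (a n)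

theorem polyMap_bohrPoly_primePoint (a : ℕ → ℂ) (N : ℕ) (s : HalfPlane) :
    polyMap (bohrPoly a N) (primePoint s) = dirichletSum a N s := by
  rw [bohrPoly, map_sum, ContinuousMap.sum_apply]
  refine Finset.sum_congr rfl fun n hn => ?_
  rw [polyMap_monomial_primePoint,
    primePow_exponents (Nat.pos_iff_ne_zero.1 (Finset.mem_Icc.1 hn).1)]

theorem exists_norm_dirichletSum_dirichletCoeff_le (s : HalfPlane) : ∃ C, 0 ≤ C ∧
    ∀ (p : MvPolynomial ℕ ℂ) (M : ℝ), (∀ s, ‖polyMap p (primePoint s)‖ ≤ M) →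
      ∀ L, ‖dirichletSum (dirichletCoeff p) L s‖ ≤ C * M := by
  obtain ⟨C, hC0, hC⟩ := exists_norm_dirichletSum_le s.2
  refine ⟨C, hC0, fun p M hM L => ?_⟩
  obtain ⟨N₀, hN₀⟩ := exists_polyMap_primePoint_eq p
  refine hC _ (max N₀ L) M (fun z hz => ?_) L (le_max_right _ _)
  rw [← hN₀ _ (le_max_left _ _) ⟨z, hz⟩]
  exact hM _

theorem exists_norm_coeff_mul_primePow_le (s : HalfPlane) : ∃ C, 0 ≤ C ∧
    ∀ (p : MvPolynomial ℕ ℂ) (M : ℝ), (∀ s, ‖polyMap p (primePoint s)‖ ≤ M) →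
      ∀ d, ‖p.coeff d * (primePow d : ℂ) ^ (-(s : ℂ))‖ ≤ C * M := by
  obtain ⟨C, hC0, hC⟩ := exists_norm_coeff_le s.2
  refine ⟨C, hC0, fun p M hM d => ?_⟩
  obtain ⟨N₀, hN₀⟩ := exists_polyMap_primePoint_eq p
  rw [← dirichletCoeff_primePow p]
  refine hC _ (max N₀ (primePow d)) M (fun z hz => ?_) _
    (Finset.mem_Icc.2 ⟨Nat.pos_of_ne_zero (primePow_ne_zero d), le_max_right _ _⟩)
  rw [← hN₀ _ (le_max_left _ _) ⟨z, hz⟩]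
  exact hM _

/-! ### The half-plane is norming -/

theorem le_of_forall_pow_le_mul_pow {x M A : ℝ} (hM : 0 ≤ M)
    (h : ∀ k : ℕ, x ^ k ≤ A * M ^ k) : x ≤ M := by
  by_contra! hlt
  obtain rfl | hM := hM.eq_or_lt
  · exact hlt.not_ge (by simpa using h 1)
  · obtain ⟨k, hk⟩ := pow_unbounded_of_one_lt A ((one_lt_div hM).2 hlt)
    rw [div_pow, lt_div_iff₀ (pow_pos hM k)] at hk
    exact hk.not_ge (h k)

theorem summable_norm_primePow_cpow_neg (s : HalfPlane) (S : Finset ℕ) :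
    Summable fun d : {d : ℕ →₀ ℕ // d.support ⊆ S} => ‖(primePow d : ℂ) ^ (-(s : ℂ))‖ := by
  have hi : Function.Injective fun d : {d : ℕ →₀ ℕ // d.support ⊆ S} =>
      (⟨primePow d, primePow_mem_factoredNumbers d.2⟩ :
        Nat.factoredNumbers (S.image (Nat.nth Nat.Prime))) := fun d e hde =>
    Subtype.ext (primePow_injective (Subtype.ext_iff.1 hde))
  have hsum : Summable fun n : Nat.factoredNumbers (S.image (Nat.nth Nat.Prime)) =>
      ‖((n : ℕ) : ℂ) ^ (-(s : ℂ))‖ :=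
    (EulerProduct.summable_and_hasSum_factoredNumbers_prod_filter_prime_geometric
      (f := (riemannZetaSummandHom s.ne_zero : ℕ →* ℂ))
      (norm_prime_cpow_neg_lt_one s) (S.image (Nat.nth Nat.Prime))).1
  simpa only [Function.comp_def] using hsum.comp_injective hi

theorem polyMap_mul_primePoint (p : MvPolynomial ℕ ℂ) (ω : Polydisc) (s : HalfPlane) :
    polyMap p (ω * primePoint s) = ∑ d ∈ p.support,
      p.coeff d * (primePow d : ℂ) ^ (-(s : ℂ)) * d.prod fun j k => (ω j : ℂ) ^ k := by
  rw [polyMap_eq_sum]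
  refine Finset.sum_congr rfl fun d _ => ?_
  simp only [Pi.mul_apply, Metric.unitClosedBall.coe_mul, mul_pow, Finsupp.prod_mul,
    prod_primePoint_pow]
  ring

theorem norm_prod_pow_le_one (d : ℕ →₀ ℕ) (ω : Polydisc) :
    ‖d.prod fun j k => (ω j : ℂ) ^ k‖ ≤ 1 := by
  rw [Finsupp.prod, norm_prod]
  refine Finset.prod_le_one (fun _ _ => norm_nonneg _) fun j _ => ?_
  rw [norm_pow]
  exact pow_le_one₀ (norm_nonneg _) (mem_closedBall_zero_iff.1 (ω j).2)

/-- Applied to the powers `p ^ k`, whose variables are those of `p`, the crude bound for the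
coefficients costs a constant independent of `k`, which disappears on taking `k`-th roots. -/
theorem norm_polyMap_mul_primePoint_le {p : MvPolynomial ℕ ℂ} {M : ℝ}
    (hM : ∀ s, ‖polyMap p (primePoint s)‖ ≤ M) (ω : Polydisc) (s : HalfPlane) :
    ‖polyMap p (ω * primePoint s)‖ ≤ M := by
  let t : HalfPlane := ⟨s / 2, by simpa using s.2⟩
  have ht : (t : ℂ) + t = s := add_halves _
  obtain ⟨C, hC0, hC⟩ := exists_norm_coeff_mul_primePow_le t
  have hA := summable_norm_primePow_cpow_neg t p.vars
  have hM0 : 0 ≤ M := (norm_nonneg _).trans (hM s)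
  refine le_of_forall_pow_le_mul_pow hM0
    (A := C * ∑' d : {d : ℕ →₀ ℕ // d.support ⊆ p.vars}, ‖(primePow d : ℂ) ^ (-(t : ℂ))‖)
    fun k => ?_
  have hpow : ∀ s, ‖polyMap (p ^ k) (primePoint s)‖ ≤ M ^ k := fun s => by
    rw [map_pow, ContinuousMap.pow_apply, norm_pow]
    exact pow_le_pow_left₀ (norm_nonneg _) (hM s) k
  have hvars : ∀ d ∈ (p ^ k).support, d.support ⊆ p.vars := fun d hd j hj =>
    MvPolynomial.vars_pow p k ((MvPolynomial.mem_vars_iff_mem_support j).2 ⟨d, hd, hj⟩)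
  rw [← norm_pow, ← ContinuousMap.pow_apply, ← map_pow, polyMap_mul_primePoint]
  calc _ ≤ ∑ d ∈ (p ^ k).support, C * M ^ k * ‖(primePow d : ℂ) ^ (-(t : ℂ))‖ := by
        refine norm_sum_le_of_le _ fun d _ => ?_
        rw [norm_mul, ← ht, neg_add,
          Complex.cpow_add _ _ (Nat.cast_ne_zero.2 (primePow_ne_zero d)), ← mul_assoc, norm_mul]
        refine (mul_le_of_le_one_right (by positivity) (norm_prod_pow_le_one d ω)).trans ?_
        gcongr
        exact hC _ _ hpow d
    _ ≤ C * M ^ k * ∑' d : {d : ℕ →₀ ℕ // d.support ⊆ p.vars},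
          ‖(primePow d : ℂ) ^ (-(t : ℂ))‖ := by
        rw [← Finset.mul_sum, ← Finset.sum_subtype_of_mem _ hvars]
        gcongr
        exact hA.sum_le_tsum _ fun _ _ => norm_nonneg _
    _ = _ := by ring

theorem exists_tendsto_primePoint_one :
    ∃ s : ℕ → HalfPlane, Tendsto (fun n => primePoint (s n)) atTop (𝓝 1) := by
  refine ⟨fun n => ⟨(1 / ((n : ℝ) + 1) : ℝ), by rw [Complex.ofReal_re]; positivity⟩, ?_⟩
  refine tendsto_pi_nhds.2 fun j => tendsto_subtype_rng.2 ?_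
  have hcont : Continuous fun x : ℝ => (Nat.nth Nat.Prime j : ℂ) ^ (-(x : ℂ)) :=
    Continuous.const_cpow (by fun_prop) (Or.inl (Nat.cast_ne_zero.2 (nth_prime j).ne_zero))
  exact (hcont.tendsto' 0 1 (by simp)).comp tendsto_one_div_add_atTop_nhds_zero_nat

theorem isNorming_primePoint : IsNorming primePoint := by
  intro p M hM
  obtain ⟨s, hs⟩ := exists_tendsto_primePoint_one
  refine (polyMap p).norm_le_of_nonempty.2 fun ω => ?_
  have hlim : Tendsto (fun n => ω * primePoint (s n)) atTop (𝓝 ω) := by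
    simpa only [mul_one] using hs.const_mul ω
  exact le_of_tendsto (((polyMap p).continuous.tendsto ω).comp hlim).norm
    (Eventually.of_forall fun n => norm_polyMap_mul_primePoint_le hM ω (s n))

/-! ### Uniform limits of polynomials on the half-plane -/

theorem norm_polyMap_primePoint_le (p : MvPolynomial ℕ ℂ) (s : HalfPlane) :
    ‖polyMap p (primePoint s)‖ ≤ ‖polyMap p‖ := (polyMap p).norm_coe_le_norm _

theorem dirichletSum_dirichletCoeff_sub (p q : MvPolynomial ℕ ℂ) (N : ℕ) (s : ℂ) :
    dirichletSum (dirichletCoeff (p - q)) N s =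
      dirichletSum (dirichletCoeff p) N s - dirichletSum (dirichletCoeff q) N s := by
  simp only [dirichletSum, dirichletCoeff, MvPolynomial.coeff_sub, sub_mul,
    Finset.sum_sub_distrib]

theorem exists_norm_coeff_le_mul_norm_polyMap (d : ℕ →₀ ℕ) :
    ∃ C, ∀ p : MvPolynomial ℕ ℂ, ‖p.coeff d‖ ≤ C * ‖polyMap p‖ := by
  let s : HalfPlane := ⟨1, by simp⟩
  obtain ⟨C, -, hC⟩ := exists_norm_coeff_mul_primePow_le s
  have hne : (primePow d : ℂ) ^ (-(s : ℂ)) ≠ 0 :=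
    (Complex.cpow_ne_zero_iff_of_exponent_ne_zero (neg_ne_zero.2 s.ne_zero)).2
      (Nat.cast_ne_zero.2 (primePow_ne_zero d))
  refine ⟨C / ‖(primePow d : ℂ) ^ (-(s : ℂ))‖, fun p => ?_⟩
  rw [div_mul_eq_mul_div, le_div_iff₀ (norm_pos_iff.2 hne), ← norm_mul]
  exact hC p _ (norm_polyMap_primePoint_le p) d

theorem exists_tendsto_coeff {p : ℕ → MvPolynomial ℕ ℂ} (hp : CauchySeq fun k => polyMap (p k))
    (d : ℕ →₀ ℕ) : ∃ c, Tendsto (fun k => (p k).coeff d) atTop (𝓝 c) := by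
  obtain ⟨C, hC⟩ := exists_norm_coeff_le_mul_norm_polyMap d
  refine cauchySeq_tendsto_of_complete (cauchySeq_iff_tendsto_dist_atTop_0.2 ?_)
  have hlim := (cauchySeq_iff_tendsto_dist_atTop_0.1 hp).const_mul C
  rw [mul_zero] at hlim
  refine squeeze_zero (fun _ => dist_nonneg) (fun kl => ?_) hlim
  rw [dist_eq_norm, dist_eq_norm, ← MvPolynomial.coeff_sub, ← map_sub]
  exact hC _

theorem tendstoUniformly_dirichletSum {p : ℕ → MvPolynomial ℕ ℂ}
    (hp : CauchySeq fun k => polyMap (p k)) {a : ℕ → ℂ}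
    (ha : ∀ n, Tendsto (fun k => dirichletCoeff (p k) n) atTop (𝓝 (a n))) (s : HalfPlane) :
    TendstoUniformly (fun k N => dirichletSum (dirichletCoeff (p k)) N s)
      (fun N => dirichletSum a N s) atTop := by
  obtain ⟨C, hC0, hC⟩ := exists_norm_dirichletSum_dirichletCoeff_le s
  rw [← tendstoUniformlyOn_univ]
  refine UniformCauchySeqOn.tendstoUniformlyOn_of_tendsto
    (Metric.uniformCauchySeqOn_iff.2 fun ε hε => ?_)
    fun N _ => tendsto_finsetSum _ fun n _ => (ha n).mul_const _
  obtain ⟨K, hK⟩ := Metric.cauchySeq_iff.1 hp (ε / (C + 1)) (by positivity)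
  refine ⟨K, fun k hk l hl N _ => ?_⟩
  rw [dist_eq_norm, ← dirichletSum_dirichletCoeff_sub]
  have hkl := hK k hk l hl
  rw [dist_eq_norm, ← map_sub, lt_div_iff₀ (by positivity)] at hkl
  nlinarith [hC _ _ (norm_polyMap_primePoint_le (p k - p l)) N, norm_nonneg (polyMap (p k - p l))]

theorem exists_hasDirichletSeries {F : C(Polydisc, ℂ)} (hF : F ∈ polydiscAlgebra) :
    ∃ a, HasDirichletSeries a fun s => F (primePoint s) := by
  obtain ⟨P, hP, hlim⟩ := mem_closure_iff_seq_limit.1 hF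
  choose p hp using hP
  obtain rfl : (fun k => polyMap (p k)) = P := funext hp
  choose a ha using fun n => exists_tendsto_coeff hlim.cauchySeq (exponents n)
  refine ⟨a, fun s => ?_⟩
  refine (tendstoUniformly_dirichletSum hlim.cauchySeq ha s).tendsto_of_eventually_tendsto
    (L := fun k => polyMap (p k) (primePoint s)) (Eventually.of_forall fun k => ?_)
    (((continuous_eval_const (primePoint s)).tendsto F).comp hlim)
  obtain ⟨N₀, hN₀⟩ := exists_polyMap_primePoint_eq (p k)
  exact tendsto_const_nhds.congr' ((eventually_ge_atTop N₀).mono fun N hN => hN₀ N hN s)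

theorem mem_dirichletSubmodule_of_isPolyLimit {f : HalfPlane → ℂ}
    (hf : IsPolyLimit primePoint f) : f ∈ dirichletSubmodule := by
  refine ⟨?_, uniformContinuous_of_isPolyLimit uniformContinuous_primePoint hf⟩
  obtain ⟨F, hF, hFf⟩ := isNorming_primePoint.exists_mem_polydiscAlgebra hf
  obtain rfl : (fun s => F (primePoint s)) = f := funext hFf
  exact exists_hasDirichletSeries hF

/-! ### Smoothing along vertical lines -/

/-- The vertical translate of a point of the half-plane, normalised so that `n ^ (-s)` gets
multiplied by the Fourier character `𝐞 (-t * log n)`. -/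
noncomputable def HalfPlane.verticalShift (s : HalfPlane) (t : ℝ) : HalfPlane :=
  ⟨s + 2 * Real.pi * t * Complex.I, by simpa using s.2⟩

theorem HalfPlane.continuous_verticalShift (s : HalfPlane) : Continuous s.verticalShift :=
  Continuous.subtype_mk (by fun_prop) _

theorem HalfPlane.dist_verticalShift (s : HalfPlane) (t : ℝ) :
    dist s (s.verticalShift t) = 2 * Real.pi * |t| := by
  rw [Subtype.dist_eq, verticalShift, dist_self_add_right]
  simp [abs_of_pos Real.pi_pos]

theorem exists_norm_dirichletSum_verticalShift_le {a : ℕ → ℂ} {f : HalfPlane → ℂ}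
    (ha : HasDirichletSeries a f) (s : HalfPlane) : ∃ C, ∀ (N : ℕ) (t : ℝ),
      ‖dirichletSum a N (s.verticalShift t)‖ ≤ C * (1 + |t|) := by
  let z : HalfPlane := ⟨s / 2, by simpa using s.2⟩
  obtain ⟨B, hB⟩ := (ha z).norm.bddAbove_range
  replace hB : ∀ N, ‖dirichletSum a N z‖ ≤ B := fun N => hB ⟨N, rfl⟩
  have hB0 : 0 ≤ B := (norm_nonneg _).trans (hB 0)
  set T := ∑' n : ℕ, (n : ℝ) ^ (0 - (z : ℂ).re - 1)
  have : 0 ≤ T := tsum_nonneg fun n => by positivity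
  refine ⟨B * (1 + (‖(z : ℂ)‖ + 2 * Real.pi) * T), fun N t => ?_⟩
  let w : HalfPlane := z.verticalShift t
  have hwre : (w : ℂ).re = (z : ℂ).re := by simp [w, HalfPlane.verticalShift]
  have hw : ‖(w : ℂ)‖ ≤ (‖(z : ℂ)‖ + 2 * Real.pi) * (1 + |t|) := by
    refine (norm_add_le _ _).trans ?_
    have : ‖2 * (Real.pi : ℂ) * t * Complex.I‖ = 2 * Real.pi * |t| := by
      simp [abs_of_pos Real.pi_pos]
    rw [this]
    nlinarith [norm_nonneg (z : ℂ), Real.pi_pos, abs_nonneg t,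
      mul_nonneg (norm_nonneg (z : ℂ)) (abs_nonneg t)]
  have hsum : ((s.verticalShift t : HalfPlane) : ℂ) = z + w := by
    simp only [HalfPlane.verticalShift, z, w]
    ring
  have h := norm_dirichletSum_add_le (w := (w : ℂ)) hB0 le_rfl
    (fun n (_ : n ≤ N) => by simpa using hB n) w.2
  rw [hwre] at h
  rw [hsum]
  calc _ ≤ B * (1 + ‖(w : ℂ)‖ * T) := h
    _ ≤ B * (1 * (1 + |t|) + (‖(z : ℂ)‖ + 2 * Real.pi) * (1 + |t|) * T) := by
        gcongr
        linarith [abs_nonneg t]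
    _ = _ := by ring

theorem continuous_dirichletSum_verticalShift (a : ℕ → ℂ) (N : ℕ) (s : HalfPlane) :
    Continuous fun t => dirichletSum a N (s.verticalShift t) := by
  refine continuous_finsetSum _ fun n hn => continuous_const.mul ?_
  exact Continuous.const_cpow
    (continuous_subtype_val.comp s.continuous_verticalShift).neg
    (Or.inl (Nat.cast_ne_zero.2 (Nat.pos_iff_ne_zero.1 (Finset.mem_Icc.1 hn).1)))

theorem integral_mul_verticalShift {a : ℕ → ℂ} {f : HalfPlane → ℂ} (ha : HasDirichletSeries a f)
    {g : ℝ → ℂ} (hg : Integrable g) (hg' : Integrable fun t => |t| * ‖g t‖) {N : ℕ}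
    (hN : ∀ n > N, 𝓕 g (Real.log n) = 0) (s : HalfPlane) :
    ∫ t, g t * f (s.verticalShift t) = dirichletSum (fun n => a n * 𝓕 g (Real.log n)) N s := by
  obtain ⟨C, hC⟩ := exists_norm_dirichletSum_verticalShift_le ha s
  have hlim : Tendsto (fun L => ∫ t, g t * dirichletSum a L (s.verticalShift t)) atTop
      (𝓝 (∫ t, g t * f (s.verticalShift t))) := by
    refine tendsto_integral_of_dominated_convergence (fun t => C * (‖g t‖ + |t| * ‖g t‖))
      (fun L => hg.aestronglyMeasurable.mul
        (continuous_dirichletSum_verticalShift a L s).aestronglyMeasurable)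
      ((hg.norm.add hg').const_mul C) (fun L => Eventually.of_forall fun t => ?_)
      (Eventually.of_forall fun t => (ha (s.verticalShift t)).const_mul (g t))
    rw [norm_mul]
    calc _ ≤ ‖g t‖ * (C * (1 + |t|)) := by gcongr; exact hC L t
      _ = _ := by ring
  refine tendsto_nhds_unique hlim (tendsto_const_nhds.congr' ?_)
  filter_upwards [eventually_ge_atTop N] with L hL
  refine Eq.trans ?_ (integral_mul_dirichletSum hg a L s).symm
  refine Finset.sum_subset (Finset.Icc_subset_Icc_right hL) fun n hn hnN => ?_
  have hn' : N < n := by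
    by_contra hle
    exact hnN (Finset.mem_Icc.2 ⟨(Finset.mem_Icc.1 hn).1, not_lt.1 hle⟩)
  simp only [hN n hn', mul_zero, zero_mul]

theorem exists_norm_sub_verticalShift_le {f : HalfPlane → ℂ} (hu : UniformContinuous f) {M : ℝ}
    (hM : ∀ s, ‖f s‖ ≤ M) {ε : ℝ} (hε : 0 < ε) :
    ∃ C, 0 ≤ C ∧ ∀ s t, ‖f s - f (s.verticalShift t)‖ ≤ ε + C * |t| := by
  obtain ⟨δ, hδ, hfδ⟩ := Metric.uniformContinuous_iff.1 hu ε hε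
  have hM0 : 0 ≤ M := (norm_nonneg _).trans (hM (Classical.arbitrary _))
  refine ⟨2 * M * (2 * Real.pi) / δ, by positivity, fun s t => ?_⟩
  obtain hlt | hge := lt_or_ge (2 * Real.pi * |t|) δ
  · rw [← dist_eq_norm]
    exact (hfδ ((s.dist_verticalShift t).trans_lt hlt)).le.trans
      (le_add_of_nonneg_right (by positivity))
  · have hfar : 2 * M ≤ 2 * M * (2 * Real.pi) / δ * |t| := by
      rw [div_mul_eq_mul_div, le_div_iff₀ hδ, mul_assoc (2 * M)]
      gcongr
    linarith [norm_sub_le_of_le (hM s) (hM (s.verticalShift t))]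

theorem norm_sub_integral_mul_verticalShift_le {f : HalfPlane → ℂ} (hf : Continuous f) {M : ℝ}
    (hM : ∀ s, ‖f s‖ ≤ M) {g : ℝ → ℂ} (hg : Integrable g)
    (hg' : Integrable fun t => |t| * ‖g t‖) (hg1 : ∫ t, g t = 1) {ε C : ℝ} {s : HalfPlane}
    (h : ∀ t, ‖f s - f (s.verticalShift t)‖ ≤ ε + C * |t|) :
    ‖f s - ∫ t, g t * f (s.verticalShift t)‖ ≤
      ε * (∫ t, ‖g t‖) + C * ∫ t, |t| * ‖g t‖ := by
  have hint : Integrable fun t => g t * f (s.verticalShift t) :=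
    hg.mul_bdd (c := M) (hf.comp s.continuous_verticalShift).aestronglyMeasurable
      (Eventually.of_forall fun t => hM _)
  have hsub : f s - ∫ t, g t * f (s.verticalShift t) =
      ∫ t, g t * (f s - f (s.verticalShift t)) := by
    simp only [mul_sub]
    rw [integral_sub (hg.mul_const _) hint, integral_mul_const, hg1, one_mul]
  rw [hsub, ← integral_const_mul, ← integral_const_mul,
    ← integral_add (hg.norm.const_mul _) (hg'.const_mul _)]
  refine norm_integral_le_of_norm_le ((hg.norm.const_mul _).add (hg'.const_mul _))
    (Eventually.of_forall fun t => ?_)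
  rw [norm_mul]
  calc _ ≤ ‖g t‖ * (ε + C * |t|) := by gcongr; exact h t
    _ = _ := by ring

/-- The dilations of `kernel`, which form an approximate identity as `c → ∞`. -/
noncomputable def dilatedKernel (c t : ℝ) : ℂ := c * kernel (c * t)

section DilatedKernel

variable {c : ℝ} (hc : 0 < c)
include hc

theorem norm_dilatedKernel (t : ℝ) : ‖dilatedKernel c t‖ = c * ‖kernel (c * t)‖ := by
  rw [dilatedKernel, norm_mul, Complex.norm_real, Real.norm_of_nonneg hc.le]

theorem abs_mul_norm_dilatedKernel (t : ℝ) :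
    |t| * ‖dilatedKernel c t‖ = |c * t| * ‖kernel (c * t)‖ := by
  rw [norm_dilatedKernel hc, abs_mul, abs_of_pos hc]
  ring

theorem integrable_dilatedKernel : Integrable (dilatedKernel c) :=
  (integrable_kernel_comp_mul_left hc.ne').const_mul _

theorem integrable_abs_mul_norm_dilatedKernel :
    Integrable fun t => |t| * ‖dilatedKernel c t‖ := by
  have h : Integrable fun u : ℝ => |u| * ‖kernel u‖ := by
    simpa using kernel.integrable_pow_mul volume 1
  simpa only [abs_mul_norm_dilatedKernel hc] using h.comp_mul_left' hc.ne'

theorem integral_dilatedKernel : ∫ t, dilatedKernel c t = 1 := by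
  simp only [dilatedKernel]
  rw [integral_const_mul, Measure.integral_comp_mul_left (fun u => kernel u), integral_kernel,
    abs_of_pos (inv_pos.2 hc)]
  simp [hc.ne']

theorem integral_norm_dilatedKernel : ∫ t, ‖dilatedKernel c t‖ = ∫ u, ‖kernel u‖ := by
  simp only [norm_dilatedKernel hc]
  rw [integral_const_mul, Measure.integral_comp_mul_left (fun u => ‖kernel u‖),
    abs_of_pos (inv_pos.2 hc), smul_eq_mul, mul_inv_cancel_left₀ hc.ne']

theorem integral_abs_mul_norm_dilatedKernel :
    ∫ t, |t| * ‖dilatedKernel c t‖ = c⁻¹ * ∫ u, |u| * ‖kernel u‖ := by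
  simp only [abs_mul_norm_dilatedKernel hc]
  rw [Measure.integral_comp_mul_left (fun u => |u| * ‖kernel u‖), abs_of_pos (inv_pos.2 hc),
    smul_eq_mul]

theorem fourier_dilatedKernel_eq_zero {x : ℝ} (hx : c ≤ x) : 𝓕 (dilatedKernel c) x = 0 := by
  have hcut : cutoff (x / c) = 0 :=
    cutoff_eq_zero (((one_le_div hc).2 hx).trans (le_abs_self _))
  have hsmul : 𝓕 (dilatedKernel c) x = (c : ℂ) • 𝓕 (fun t => kernel (c * t)) x :=
    congrFun (VectorFourier.fourierIntegral_const_smul _ _ _ _ _) x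
  rw [hsmul, fourier_kernel_comp_mul_left hc, hcut, Complex.ofReal_zero, smul_zero,
    smul_zero]

end DilatedKernel

theorem isPolyLimit_of_mem_dirichletSubmodule {f : HalfPlane → ℂ} (hf : f ∈ dirichletSubmodule) :
    IsPolyLimit primePoint f := by
  intro ε hε
  obtain ⟨M, hM⟩ := bounded_of_mem_dirichletSubmodule f hf
  replace hM : ∀ s, ‖f s‖ ≤ M := fun s => hM ⟨s, rfl⟩
  obtain ⟨⟨a, ha⟩, hu⟩ := hf
  set A := ∫ u, ‖kernel u‖
  set A' := ∫ u, |u| * ‖kernel u‖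
  have : 0 ≤ A := integral_nonneg fun _ => norm_nonneg _
  have : 0 ≤ A' := integral_nonneg fun _ => by positivity
  obtain ⟨C, hC0, hC⟩ := exists_norm_sub_verticalShift_le hu hM
    (show 0 < ε / (2 * (A + 1)) by positivity)
  set c := (C * A' + 1) / (ε / 2)
  have hc : 0 < c := by positivity
  obtain ⟨N, hN⟩ := exists_nat_ge (Real.exp c)
  have hfourier : ∀ n > N, 𝓕 (dilatedKernel c) (Real.log n) = 0 := fun n hn =>
    fourier_dilatedKernel_eq_zero hc <|
      (Real.le_log_iff_exp_le (Nat.cast_pos.2 (Nat.zero_lt_of_lt hn))).2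
        (hN.trans (Nat.cast_le.2 hn.le))
  refine ⟨bohrPoly (fun n => a n * 𝓕 (dilatedKernel c) (Real.log n)) N, fun s => ?_⟩
  rw [polyMap_bohrPoly_primePoint, ← integral_mul_verticalShift ha (integrable_dilatedKernel hc)
    (integrable_abs_mul_norm_dilatedKernel hc) hfourier]
  refine (norm_sub_integral_mul_verticalShift_le hu.continuous hM (integrable_dilatedKernel hc)
    (integrable_abs_mul_norm_dilatedKernel hc) (integral_dilatedKernel hc) (hC s)).trans ?_
  rw [integral_norm_dilatedKernel hc, integral_abs_mul_norm_dilatedKernel hc]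
  have hnear : ε / (2 * (A + 1)) * A ≤ ε / 2 := by
    rw [div_mul_eq_mul_div, div_le_div_iff₀ (by positivity) two_pos]
    nlinarith
  have htail : C * (c⁻¹ * A') ≤ ε / 2 := by
    rw [mul_left_comm, inv_mul_le_iff₀ hc, div_mul_cancel₀ _ (half_pos hε).ne']
    exact (lt_add_one _).le
  linarith

theorem mem_dirichletSubmodule_iff (f : HalfPlane → ℂ) :
    f ∈ dirichletSubmodule ↔ IsPolyLimit primePoint f :=
  ⟨isPolyLimit_of_mem_dirichletSubmodule, mem_dirichletSubmodule_of_isPolyLimit⟩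

/-- The polydisc algebra realised as the algebra `𝒜(ℂ₊)`, by restriction to the half-plane. -/
noncomputable def dirichletEquiv : polydiscAlgebra ≃ₗᵢ[ℂ] DirichletAlgebra where
  toLinearEquiv := isNorming_primePoint.restrictEquiv mem_dirichletSubmodule_iff
  norm_map' F := isNorming_primePoint.iSup_norm_eq F.2

theorem dirichletEquiv_apply (F : polydiscAlgebra) (s : HalfPlane) :
    dirichletEquiv F s = (F : C(Polydisc, ℂ)) (primePoint s) := rfl

end BohrLift

theorem mainTheorem2 :
    ∃ Φ : BohrLift.DirichletAlgebra ≃ₗᵢ[ℂ] BohrLift.BallAlgebra,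
      (∀ f g : BohrLift.DirichletAlgebra, ∃ h : BohrLift.DirichletAlgebra,
        (∀ s, h s = f s * g s) ∧ ∀ z, Φ h z = Φ f z * Φ g z) ∧
      ∀ α : ℕ →₀ ℕ, ∃ f : BohrLift.DirichletAlgebra,
        (∀ s : BohrLift.HalfPlane, f s = (BohrLift.primePow α : ℂ) ^ (-(s : ℂ))) ∧
        ∀ z, Φ f z = BohrLift.monomial α z := by
  refine ⟨BohrLift.dirichletEquiv.symm.trans BohrLift.ballEquiv, fun f g => ?_, fun α => ?_⟩
  · obtain ⟨F, rfl⟩ := BohrLift.dirichletEquiv.surjective f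
    obtain ⟨G, rfl⟩ := BohrLift.dirichletEquiv.surjective g
    refine ⟨BohrLift.dirichletEquiv (F * G), fun s => ?_, fun z => ?_⟩
    · simp only [BohrLift.dirichletEquiv_apply, MulMemClass.coe_mul, ContinuousMap.mul_apply]
    · simp only [LinearIsometryEquiv.trans_apply, LinearIsometryEquiv.symm_apply_apply,
        BohrLift.ballEquiv_apply, MulMemClass.coe_mul, ContinuousMap.mul_apply]
  · refine ⟨BohrLift.dirichletEquiv ⟨BohrLift.polyMap (MvPolynomial.monomial α 1),
      BohrLift.polyMap_mem_polydiscAlgebra _⟩, fun s => ?_, fun z => ?_⟩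
    · rw [BohrLift.dirichletEquiv_apply, BohrLift.polyMap_monomial_primePoint, one_mul]
    · rw [LinearIsometryEquiv.trans_apply, LinearIsometryEquiv.symm_apply_apply,
        BohrLift.ballEquiv_apply, BohrLift.polyMap_monomial, one_mul]
      rfl
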